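/- **Theorem 3 (marginal posterior consistency).** Let $\gamma>0$, $0<k_1\le 1$, $k_2\ge 2$ and $\rho\in(0,1)$ be fixed. For each $n$ let $X_n$ be a real $n\times p_n$ matrix and $\beta_n^0\in\mathbb R^{p_n}$, and let the observation $y_n\in\mathbb R^n$ have law $F_{\beta_n^0}=\mathrm N(X_n\beta_n^0,\gamma^{-1}I_n)$; all $y_n$ are defined on one probability space, with arbitrary joint law. Let $C_n>0$ be real numbers. *Model.* Given $\beta_n$ and the known precision $\gamma$, $y_n\sim \mathrm N(X_n\beta_n,\gamma^{-1}I_n)$. Given $\theta_n=(\lambda_n,\alpha_n,\kappa_n)$, with $\lambda_n=(\lambda_{n1},\dots,\lambda_{np_n})$, the coefficient vector $\beta_n\in\mathbb R^{p_n}$ has prior density $$\nu(\beta_n\mid\gamma,\lambda_n,\alpha_n)=\Big(\frac{\alpha_n\gamma^{1/\alpha_n}}{2^{1/\alpha_n+1}\Gamma(1/\alpha_n)}\Big)^{p_n}\Big(\prod_{j=1}^{p_n}\lambda_{nj}\Big)^{1/\alpha_n}\exp\Big\{-\frac{\gamma}{2}\sum_{j=1}^{p_n}\lambda_{nj}|\beta_{nj}|^{\alpha_n}\Big\}.$$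 Here $\alpha_n\sim\mathrm{Unif}(k_1,k_2)$, the $\kappa_{nj}$ are i.i.d. $\mathrm{Bern}(1/2)$ and independent of $\alpha_n$, and $$\lambda_{nj}=\big(C_n\sqrt{p_n}\,n^{\rho/2}\log n\big)^{\alpha_n},\qquad j=1,\dots,p_n .$$ Let $Q_n(\cdot\mid y_n)$ be the marginal posterior distribution of $\beta_n$ given $y_n$, that is, the posterior of $(\beta_n,\theta_n)$ with $\theta_n$ integrated out. *Assumptions.* As $n\to\infty$: 1. $p_n=o(n)$; 2. if $\Lambda_{n\min}$ and $\Lambda_{n\max}$ are the smallest and largest singular values of $X_n$, there are constants with $0<\Lambda_{\min}<\liminf_n \Lambda_{n\min}/\sqrt n\le\limsup_n\Lambda_{n\max}/\sqrt n<\Lambda_{\max}<\infty$; 3. $\sup_n\max_{1\le j\le p_n}|\beta^0_{nj}|<\infty$; 4. the number $m_n$ of nonzero entries of $\beta_n^0$ satisfies $m_n=o\{n^{1-\rho}/(p_n\log^2 n)\}$; 5. $C_n^2=o(n)$. *Conclusion.* For every $\epsilon>0$, as $n\to\infty$, $$Q_n\big(\{\beta_n:\|\beta_n-\beta_n^0\|>\epsilon\}\mid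 y_n\big)\to 0\qquad\text{almost surely},$$ where $\|\cdot\|$ is the Euclidean norm. -/

import Mathlib

open MeasureTheory ProbabilityTheory Filter Asymptotics
open scoped Topology ENNReal

namespace BayesPenalized

/-- The `k`-dimensional Euclidean space. -/
abbrev E (k : ℕ) : Type := EuclideanSpace ℝ (Fin k)

noncomputable section

/-- The mean `X β` of the response, with the Euclidean structure on both sides. -/
def mean {n p : ℕ} (X : Matrix (Fin n) (Fin p) ℝ) (β : E p) : E n :=
  Matrix.toEuclideanLin X β

/-- The sampling distribution `N(X β, γ⁻¹ I_n)` of the response. -/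
def dataLaw {n p : ℕ} (X : Matrix (Fin n) (Fin p) ℝ) (γ : ℝ) (β : E p) : Measure (E n) :=
  multivariateGaussian (mean X β) (γ⁻¹ • (1 : Matrix (Fin n) (Fin n) ℝ))

/-- The likelihood: the Lebesgue density of `N(X β, γ⁻¹ I_n)` at `y`. -/
def likelihood {n p : ℕ} (X : Matrix (Fin n) (Fin p) ℝ) (γ : ℝ) (y : E n) (β : E p) : ℝ :=
  (γ / (2 * Real.pi)) ^ ((n : ℝ) / 2) * Real.exp (-(γ / 2) * ‖y - mean X β‖ ^ 2)

/-- The conditional prior density `ν(β | γ, λ, α)` of the regression coefficients. -/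
def coefPriorDensity {p : ℕ} (γ : ℝ) (lam : Fin p → ℝ) (α : ℝ) (β : E p) : ℝ :=
  (α * γ ^ (1 / α) / (2 ^ (1 / α + 1) * Real.Gamma (1 / α))) ^ p *
    (∏ i, lam i) ^ (1 / α) *
    Real.exp (-(γ / 2) * ∑ i, lam i * |β i| ^ α)

/-- The parameters `θ = (λ, α, κ)`; `κ i` is the indicator (a `Bool`) of the mixture component
attached to the `i`-th coefficient. -/
abbrev Theta (p : ℕ) : Type := (Fin p → ℝ) × ℝ × (Fin p → Bool)

/-- The prior of `θ = (λ, α, κ)` when `α ~ Unif(k₁, k₂)`, the `κ i` are independent `Bern(1/2)`,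
independent of `α`, and every `λ i` equals `L ^ α`. -/
def thetaPrior (p : ℕ) (k₁ k₂ L : ℝ) : Measure (Theta p) :=
  ((cond volume (Set.Icc k₁ k₂) : Measure ℝ).prod
      (Measure.pi fun _ : Fin p => (PMF.uniformOfFintype Bool).toMeasure)).map
    fun ακ => (fun _ => L ^ ακ.1, ακ.1, ακ.2)

/-- The joint prior `ν(dβ | θ) ν(dθ)` of `(β, θ)`. -/
def jointPrior (p : ℕ) (γ k₁ k₂ L : ℝ) : Measure (E p × Theta p) :=
  ((volume : Measure (E p)).prod (thetaPrior p k₁ k₂ L)).withDensity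
    fun q => ENNReal.ofReal (coefPriorDensity γ q.2.1 q.2.2.1 q.1)

/-- The full posterior distribution of `(β, θ)` given `y`: by Bayes' formula, the joint prior
weighted by the likelihood and normalized by the marginal density of `y`. -/
def jointPosterior {n p : ℕ} (X : Matrix (Fin n) (Fin p) ℝ) (γ k₁ k₂ L : ℝ) (y : E n) :
    Measure (E p × Theta p) :=
  (∫⁻ q, ENNReal.ofReal (likelihood X γ y q.1) ∂jointPrior p γ k₁ k₂ L)⁻¹ •
    (jointPrior p γ k₁ k₂ L).withDensity fun q => ENNReal.ofReal (likelihood X γ y q.1)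

/-- The marginal posterior distribution of `β` given `y`. -/
def marginalPosterior {n p : ℕ} (X : Matrix (Fin n) (Fin p) ℝ) (γ k₁ k₂ L : ℝ) (y : E n) :
    Measure (E p) :=
  (jointPosterior X γ k₁ k₂ L y).map Prod.fst

/-- The largest singular value of `X`. -/
def sigmaMax {n p : ℕ} (X : Matrix (Fin n) (Fin p) ℝ) : ℝ :=
  (Matrix.toEuclideanLin X).singularValues 0

/-- The smallest of the `min n p` singular values of `X`
(Mathlib lists the singular values in decreasing order, starting at index `0`). -/
def sigmaMin {n p : ℕ} (X : Matrix (Fin n) (Fin p) ℝ) : ℝ :=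
  (Matrix.toEuclideanLin X).singularValues (min n p - 1)

/-- The number of nonzero coordinates of `β`. -/
def numNonzero {p : ℕ} (β : E p) : ℕ :=
  Nat.card {j : Fin p // β j ≠ 0}

end

end BayesPenalized

/-!
Completing the square, the likelihood ratio of `β₀ + h` against `β₀` is
`exp (γ (⟪score, h⟫ - ‖X h‖² / 2))`. Gaussian concentration and the Borel–Cantelli lemma give
`‖score‖ = o(n)` almost surely, while the lower bound on the singular values makes the quadratic
term of order `-n ‖h‖²`. Up to subexponential factors, mixing the prior over
`α` produces the weight attached to the smallest exponent `k₁ ≤ 1`, whose penalty is subadditive: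
its increment from `β₀` to `β₀ + h` falls short of the penalty of `h` only through the nonzero
coordinates of `β₀`. Comparing the numerator off the `ε`-ball with
the denominator on a small box around `β₀` bounds the posterior mass by `exp (o(n) - c n)`.
-/

namespace BayesPenalized

section SingularValues

open Module

variable {V W : Type*} [NormedAddCommGroup V] [InnerProductSpace ℝ V] [FiniteDimensional ℝ V]
  [NormedAddCommGroup W] [InnerProductSpace ℝ W] [FiniteDimensional ℝ W]

theorem exists_orthonormalBasis_sq_norm_apply_eq_sum (T : V →ₗ[ℝ] W) :
    ∃ b : OrthonormalBasis (Fin (finrank ℝ V)) ℝ V, ∀ x,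
      ‖T x‖ ^ 2 = ∑ i : Fin (finrank ℝ V), T.singularValues i ^ 2 * inner ℝ (b i) x ^ 2 := by
  have hT := T.isSymmetric_adjoint_comp_self
  refine ⟨hT.eigenvectorBasis rfl, fun x => ?_⟩
  calc ‖T x‖ ^ 2 = inner ℝ ((LinearMap.adjoint T ∘ₗ T) x) x := by
        rw [LinearMap.comp_apply, LinearMap.adjoint_inner_left, real_inner_self_eq_norm_sq]
    _ = _ := by
        rw [← OrthonormalBasis.sum_inner_mul_inner (hT.eigenvectorBasis rfl)]
        refine Finset.sum_congr rfl fun i _ => ?_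
        rw [hT, hT.apply_eigenvectorBasis rfl, real_inner_comm, inner_smul_left,
          T.sq_singularValues_fin rfl i, real_inner_comm, RCLike.ofReal_real_eq_id, id,
          conj_trivial, sq (inner ℝ _ _), mul_assoc]

theorem norm_apply_le_singularValues_mul_norm (T : V →ₗ[ℝ] W) (x : V) :
    ‖T x‖ ≤ T.singularValues 0 * ‖x‖ := by
  obtain ⟨b, hb⟩ := exists_orthonormalBasis_sq_norm_apply_eq_sum T
  refine le_of_sq_le_sq ?_ (mul_nonneg (T.singularValues_nonneg 0) (norm_nonneg x))
  rw [hb, mul_pow, ← b.sum_sq_inner_right x, Finset.mul_sum]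
  gcongr with i
  · exact T.singularValues_nonneg i
  · exact T.singularValues_antitone (Nat.zero_le _)

theorem singularValues_mul_norm_le_norm_apply (T : V →ₗ[ℝ] W) (x : V) :
    T.singularValues (finrank ℝ V - 1) * ‖x‖ ≤ ‖T x‖ := by
  obtain ⟨b, hb⟩ := exists_orthonormalBasis_sq_norm_apply_eq_sum T
  refine le_of_sq_le_sq ?_ (norm_nonneg _)
  rw [hb, mul_pow, ← b.sum_sq_inner_right x, Finset.mul_sum]
  gcongr with i
  · exact T.singularValues_nonneg _
  · exact T.singularValues_antitone (by lia)

variable {n p : ℕ} (X : Matrix (Fin n) (Fin p) ℝ)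

theorem norm_mean_le (β : E p) : ‖mean X β‖ ≤ sigmaMax X * ‖β‖ :=
  norm_apply_le_singularValues_mul_norm (Matrix.toEuclideanLin X) β

theorem sigmaMin_mul_norm_le (hpn : p ≤ n) (β : E p) : sigmaMin X * ‖β‖ ≤ ‖mean X β‖ := by
  have h := singularValues_mul_norm_le_norm_apply (Matrix.toEuclideanLin X) β
  rwa [finrank_euclideanSpace_fin, show p - 1 = min n p - 1 by rw [min_eq_right hpn]] at h

end SingularValues

section SubGaussian

theorem lintegral_exp_isGaussian {V : Type*} [NormedAddCommGroup V] [NormedSpace ℝ V]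
    [MeasurableSpace V] [BorelSpace V] {μ : Measure V} [IsGaussian μ] (L : StrongDual ℝ V) :
    ∫⁻ x, ENNReal.ofReal (Real.exp (L x)) ∂μ =
      ENNReal.ofReal (Real.exp (μ[L] + Var[L; μ] / 2)) := by
  have hmap := IsGaussian.map_eq_gaussianReal (μ := μ) L
  have hint : Integrable (fun x => Real.exp (1 * L x)) μ := by
    have h := integrable_exp_mul_gaussianReal (μ := μ[L]) (v := Var[L; μ].toNNReal) 1
    rwa [← hmap, integrable_map_measure (by fun_prop) (by fun_prop)] at h
  have hmgf := mgf_gaussianReal hmap 1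
  simp only [mgf, one_mul, one_pow, mul_one, Real.coe_toNNReal _ (variance_nonneg _ _)]
    at hmgf hint
  rw [← ofReal_integral_eq_lintegral_ofReal hint (ae_of_all _ fun x => Real.exp_nonneg _), hmgf]

variable {V : Type*} [NormedAddCommGroup V] [InnerProductSpace ℝ V] [FiniteDimensional ℝ V]
  [MeasurableSpace V] [BorelSpace V]

theorem lintegral_exp_neg_mul_sq_norm_add_inner {b : ℝ} (hb : 0 < b) (w : V) :
    ∫⁻ h, ENNReal.ofReal (Real.exp (-b * ‖h‖ ^ 2 + inner ℝ w h)) =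
      ENNReal.ofReal ((Real.pi / b) ^ ((Module.finrank ℝ V : ℝ) / 2) *
        Real.exp (‖w‖ ^ 2 / (4 * b))) := by
  have hb' : 0 < (b : ℂ).re := by simpa
  have hcast : ∀ h : V, Complex.exp (-(b : ℂ) * (‖h‖ : ℂ) ^ 2 + (1 : ℂ) * (inner ℝ w h : ℝ)) =
      ((Real.exp (-b * ‖h‖ ^ 2 + inner ℝ w h) : ℝ) : ℂ) := fun h => by push_cast; rw [one_mul]
  have hint := GaussianFourier.integrable_cexp_neg_mul_sq_norm_add hb' 1 w
  have hval := GaussianFourier.integral_cexp_neg_mul_sq_norm_add hb' 1 w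
  simp_rw [hcast] at hint hval
  rw [integral_complex_ofReal] at hval
  rw [← ofReal_integral_eq_lintegral_ofReal (by exact_mod_cast hint.re)
    (ae_of_all _ fun h => Real.exp_nonneg _)]
  congr 1
  apply Complex.ofReal_injective
  rw [hval]
  push_cast [Complex.ofReal_cpow (show 0 ≤ Real.pi / b by positivity)]
  rw [one_pow, one_mul]

variable {Ω : Type*} [MeasurableSpace Ω] {μ : Measure Ω} [SFinite μ] {Z : Ω → V} {σ : ℝ}

-- Gaussian linearisation: `exp (‖z‖² / (4σ²))` is a Gaussian average of `exp ⟪z, h⟫` over `h`.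
theorem lintegral_exp_sq_norm_le_of_subGaussian (hZ : Measurable Z) (hσ : 0 < σ)
    (hsub : ∀ h, ∫⁻ ω, ENNReal.ofReal (Real.exp (inner ℝ (Z ω) h)) ∂μ ≤
      ENNReal.ofReal (Real.exp (σ ^ 2 * ‖h‖ ^ 2 / 2))) :
    ∫⁻ ω, ENNReal.ofReal (Real.exp (‖Z ω‖ ^ 2 / (4 * σ ^ 2))) ∂μ ≤
      ENNReal.ofReal (2 ^ ((Module.finrank ℝ V : ℝ) / 2)) := by
  set d : ℝ := (Module.finrank ℝ V : ℝ) / 2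
  have hc : 0 < (Real.pi / σ ^ 2) ^ d := by positivity
  have hinner : ∀ h : V,
      ∫⁻ ω, ENNReal.ofReal (Real.exp (-σ ^ 2 * ‖h‖ ^ 2 + inner ℝ (Z ω) h)) ∂μ ≤
        ENNReal.ofReal (Real.exp (-(σ ^ 2 / 2) * ‖h‖ ^ 2 + inner ℝ (0 : V) h)) := fun h => by
    simp_rw [Real.exp_add, ENNReal.ofReal_mul (Real.exp_nonneg _)]
    rw [lintegral_const_mul _ (by fun_prop)]
    refine (mul_le_mul_right (hsub h) _).trans_eq ?_
    rw [← ENNReal.ofReal_mul (Real.exp_nonneg _), ← ENNReal.ofReal_mul (Real.exp_nonneg _),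
      ← Real.exp_add, ← Real.exp_add, inner_zero_left]
    ring_nf
  refine (ENNReal.mul_le_mul_iff_right (by simpa using hc) ENNReal.ofReal_ne_top).1 ?_
  calc ENNReal.ofReal ((Real.pi / σ ^ 2) ^ d) *
        ∫⁻ ω, ENNReal.ofReal (Real.exp (‖Z ω‖ ^ 2 / (4 * σ ^ 2))) ∂μ
      = ∫⁻ ω, ∫⁻ h : V,
          ENNReal.ofReal (Real.exp (-σ ^ 2 * ‖h‖ ^ 2 + inner ℝ (Z ω) h)) ∂volume ∂μ := by
        rw [← lintegral_const_mul _ (by fun_prop)]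
        refine lintegral_congr fun ω => ?_
        rw [lintegral_exp_neg_mul_sq_norm_add_inner (pow_pos hσ 2), ENNReal.ofReal_mul hc.le]
    _ = ∫⁻ h : V, ∫⁻ ω,
          ENNReal.ofReal (Real.exp (-σ ^ 2 * ‖h‖ ^ 2 + inner ℝ (Z ω) h)) ∂μ :=
        lintegral_lintegral_swap (by fun_prop)
    _ ≤ _ := lintegral_mono hinner
    _ = ENNReal.ofReal ((Real.pi / σ ^ 2) ^ d) * ENNReal.ofReal (2 ^ d) := by
        rw [lintegral_exp_neg_mul_sq_norm_add_inner (by positivity), ← ENNReal.ofReal_mul hc.le,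
          ← Real.mul_rpow (by positivity) zero_le_two, norm_zero, zero_pow two_ne_zero, zero_div,
          Real.exp_zero, mul_one, div_div_eq_mul_div, div_mul_eq_mul_div]

theorem measure_norm_gt_le_of_subGaussian (hZ : Measurable Z) (hσ : 0 < σ)
    (hsub : ∀ h, ∫⁻ ω, ENNReal.ofReal (Real.exp (inner ℝ (Z ω) h)) ∂μ ≤
      ENNReal.ofReal (Real.exp (σ ^ 2 * ‖h‖ ^ 2 / 2))) {t : ℝ} (ht : 0 ≤ t) :
    μ {ω | t < ‖Z ω‖} ≤ ENNReal.ofReal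
      (2 ^ ((Module.finrank ℝ V : ℝ) / 2) * Real.exp (-(t ^ 2 / (4 * σ ^ 2)))) := by
  set a := Real.exp (t ^ 2 / (4 * σ ^ 2)) with ha
  have ha0 : 0 < a := Real.exp_pos _
  rw [Real.exp_neg, ← ha, ← div_eq_mul_inv, ENNReal.ofReal_div_of_pos ha0]
  calc μ {ω | t < ‖Z ω‖}
      ≤ μ {ω | ENNReal.ofReal a ≤ ENNReal.ofReal (Real.exp (‖Z ω‖ ^ 2 / (4 * σ ^ 2)))} := by
        refine measure_mono fun ω (hω : t < ‖Z ω‖) => ?_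
        rw [Set.mem_ofPred_eq, ha]
        gcongr
    _ ≤ (∫⁻ ω, ENNReal.ofReal (Real.exp (‖Z ω‖ ^ 2 / (4 * σ ^ 2))) ∂μ) / ENNReal.ofReal a :=
        meas_ge_le_lintegral_div (by fun_prop) (by simpa using ha0) ENNReal.ofReal_ne_top
    _ ≤ _ := by
        gcongr
        exact lintegral_exp_sq_norm_le_of_subGaussian hZ hσ hsub

end SubGaussian

theorem ae_eventually_of_measure_not_le_pow {Ω : Type*} [MeasurableSpace Ω] {μ : Measure Ω}
    {q : ℕ → Ω → Prop} {r : ℝ} (hr₀ : 0 ≤ r) (hr₁ : r < 1)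
    (h : ∀ᶠ n in atTop, μ {ω | ¬ q n ω} ≤ ENNReal.ofReal (r ^ n)) :
    ∀ᵐ ω ∂μ, ∀ᶠ n in atTop, q n ω := by
  obtain ⟨N, hN⟩ := eventually_atTop.1 h
  have hsum : ∑' n, μ {ω | ¬ q (n + N) ω} ≠ ∞ := by
    refine ne_top_of_le_ne_top ?_ (ENNReal.tsum_le_tsum fun n => hN (n + N) (Nat.le_add_left N n))
    exact ((summable_nat_add_iff N).2 (summable_geometric_of_lt_one hr₀ hr₁)).tsum_ofReal_ne_top
  filter_upwards [ae_eventually_notMem hsum] with ω hω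
  rw [← map_add_atTop_eq_nat N, eventually_map]
  exact hω.mono fun n hn => not_not.1 hn

section Score

/-- The score `Xᵀ (y - X β)` of the Gaussian linear model, without the factor `γ`: the gradient of
the log-likelihood at `β` is `γ • score X β y`. -/
noncomputable def score {n p : ℕ} (X : Matrix (Fin n) (Fin p) ℝ) (β : E p) (y : E n) : E p :=
  LinearMap.adjoint (Matrix.toEuclideanLin X) (y - mean X β)

variable {n p : ℕ} (X : Matrix (Fin n) (Fin p) ℝ)

theorem inner_score (β : E p) (y : E n) (h : E p) :
    inner ℝ (score X β y) h = inner ℝ (y - mean X β) (mean X h) :=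
  LinearMap.adjoint_inner_left _ _ _

theorem continuous_score (β : E p) : Continuous (score X β) :=
  (LinearMap.continuous_of_finiteDimensional _).comp (continuous_id.sub continuous_const)

variable {γ : ℝ}

theorem lintegral_exp_inner_sub_mean_dataLaw (hγ : 0 ≤ γ) (β : E p) (v : E n) :
    ∫⁻ y, ENNReal.ofReal (Real.exp (inner ℝ (y - mean X β) v)) ∂dataLaw X γ β =
      ENNReal.ofReal (Real.exp (γ⁻¹ * ‖v‖ ^ 2 / 2)) := by
  have : IsGaussian (dataLaw X γ β) := isGaussian_multivariateGaussian
  have hmean : ∫ y, innerSL ℝ v y ∂dataLaw X γ β = inner ℝ v (mean X β) := by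
    rw [ContinuousLinearMap.integral_comp_id_comm IsGaussian.integrable_id, dataLaw,
      integral_id_multivariateGaussian, innerSL_apply_apply]
  have hvar : Var[innerSL ℝ v; dataLaw X γ β] = γ⁻¹ * ‖v‖ ^ 2 := by
    have hcov := covarianceBilin_self (μ := dataLaw X γ β) IsGaussian.memLp_two_id v
    rw [coe_innerSL_apply, ← hcov, dataLaw, covarianceBilin_multivariateGaussian
      (Matrix.PosSemidef.one.smul (inv_nonneg.2 hγ)), Matrix.smul_mulVec, Matrix.one_mulVec,
      dotProduct_smul, smul_eq_mul, EuclideanSpace.real_norm_sq_eq]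
    simp [dotProduct, sq]
  have hmgf := lintegral_exp_isGaussian (μ := dataLaw X γ β) (innerSL ℝ v)
  simp_rw [inner_sub_left, sub_eq_add_neg, add_comm (inner ℝ _ v), Real.exp_add,
    ENNReal.ofReal_mul (Real.exp_nonneg _), real_inner_comm v]
  simp only [innerSL_apply_apply] at hmgf hmean
  rw [lintegral_const_mul _ (by fun_prop), hmgf, hmean, hvar,
    ← ENNReal.ofReal_mul (Real.exp_nonneg _), ← Real.exp_add, neg_add_cancel_left]

theorem dataLaw_norm_score_gt_le (hγ : 0 < γ) {S : ℝ} (hS : 0 < S)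
    (hX : ∀ h, ‖mean X h‖ ≤ S * ‖h‖) (β : E p) {t : ℝ} (ht : 0 ≤ t) :
    dataLaw X γ β {y | t < ‖score X β y‖} ≤
      ENNReal.ofReal (2 ^ ((p : ℝ) / 2) * Real.exp (-(γ * t ^ 2 / (4 * S ^ 2)))) := by
  have : IsGaussian (dataLaw X γ β) := isGaussian_multivariateGaussian
  have hsub : ∀ h, ∫⁻ y, ENNReal.ofReal (Real.exp (inner ℝ (score X β y) h)) ∂dataLaw X γ β ≤
      ENNReal.ofReal (Real.exp ((S / √γ) ^ 2 * ‖h‖ ^ 2 / 2)) := fun h => by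
    simp_rw [inner_score]
    rw [lintegral_exp_inner_sub_mean_dataLaw X hγ.le, div_pow, Real.sq_sqrt hγ.le,
      div_eq_inv_mul (S ^ 2), mul_assoc, ← mul_pow]
    gcongr
    exact hX h
  have h := measure_norm_gt_le_of_subGaussian (continuous_score X β).measurable
    (div_pos hS (Real.sqrt_pos.2 hγ)) hsub ht
  rwa [finrank_euclideanSpace_fin, div_pow, Real.sq_sqrt hγ.le, mul_div_assoc',
    div_div_eq_mul_div, mul_comm (t ^ 2)] at h

end Score

section ScoreAsymptotics

variable {γ : ℝ} {p : ℕ → ℕ} {X : (n : ℕ) → Matrix (Fin n) (Fin (p n)) ℝ} {β₀ : (n : ℕ) → E (p n)}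
  {S : ℝ}

theorem eventually_dataLaw_norm_score_gt_le (hγ : 0 < γ)
    (hp : (fun n => (p n : ℝ)) =o[atTop] (fun n : ℕ => (n : ℝ))) (hS : 0 < S)
    (hX : ∀ᶠ n : ℕ in atTop, ∀ h, ‖mean (X n) h‖ ≤ S * √(n : ℝ) * ‖h‖) {η : ℝ} (hη : 0 < η) :
    ∀ᶠ n : ℕ in atTop, dataLaw (X n) γ (β₀ n) {z | η * n < ‖score (X n) (β₀ n) z‖} ≤
      ENNReal.ofReal (Real.exp (-(γ * η ^ 2 / (8 * S ^ 2))) ^ n) := by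
  set c : ℝ := γ * η ^ 2 / (8 * S ^ 2) with hc
  have hc₀ : 0 < c := by positivity
  filter_upwards [hX, hp.def hc₀, eventually_gt_atTop 0] with n hXn hpn hn
  have hn₀ : (0 : ℝ) < n := Nat.cast_pos.2 hn
  simp only [Real.norm_natCast] at hpn
  have hpow : (2 : ℝ) ^ ((p n : ℝ) / 2) ≤ Real.exp (c * n) := by
    rw [Real.rpow_def_of_pos two_pos, Real.exp_le_exp]
    calc Real.log 2 * ((p n : ℝ) / 2) ≤ 1 * (p n : ℝ) := by
          gcongr
          · linarith [Real.log_two_lt_d9]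
          · exact half_le_self (Nat.cast_nonneg _)
      _ ≤ c * n := by rwa [one_mul]
  refine (dataLaw_norm_score_gt_le (X n) hγ (by positivity) hXn (β₀ n)
    (by positivity)).trans (ENNReal.ofReal_le_ofReal ?_)
  calc (2 : ℝ) ^ ((p n : ℝ) / 2) * Real.exp (-(γ * (η * n) ^ 2 / (4 * (S * √(n : ℝ)) ^ 2)))
      ≤ Real.exp (c * n) * Real.exp (-(2 * c * n)) := by
        have hexp : γ * (η * n) ^ 2 / (4 * (S * √(n : ℝ)) ^ 2) = 2 * c * n := by
          rw [mul_pow S, Real.sq_sqrt hn₀.le, hc]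
          field_simp
          ring
        rw [hexp]
        gcongr
    _ = Real.exp (-c) ^ n := by
        rw [← Real.exp_add, ← Real.exp_nat_mul]
        ring_nf

theorem ae_isLittleO_norm_score {Ω : Type*} [MeasurableSpace Ω] {P : Measure Ω}
    {y : (n : ℕ) → Ω → E n} (hγ : 0 < γ) (hy : ∀ n, HasLaw (y n) (dataLaw (X n) γ (β₀ n)) P)
    (hp : (fun n => (p n : ℝ)) =o[atTop] (fun n : ℕ => (n : ℝ))) (hS : 0 < S)
    (hX : ∀ᶠ n : ℕ in atTop, ∀ h, ‖mean (X n) h‖ ≤ S * √(n : ℝ) * ‖h‖) :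
    ∀ᵐ ω ∂P, (fun n => ‖score (X n) (β₀ n) (y n ω)‖) =o[atTop] (fun n : ℕ => (n : ℝ)) := by
  have hscore : ∀ k : ℕ, ∀ᵐ ω ∂P, ∀ᶠ n : ℕ in atTop,
      ‖score (X n) (β₀ n) (y n ω)‖ ≤ 1 / (k + 1) * n := fun k => by
    have hη : (0 : ℝ) < 1 / (k + 1) := Nat.one_div_pos_of_nat
    have hc : 0 < γ * (1 / (k + 1)) ^ 2 / (8 * S ^ 2) := by positivity
    refine ae_eventually_of_measure_not_le_pow (Real.exp_nonneg _)
      (Real.exp_lt_one_iff.2 (neg_lt_zero.2 hc)) <|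
      (eventually_dataLaw_norm_score_gt_le (β₀ := β₀) hγ hp hS hX hη).mono fun n hn => ?_
    have hmeas : MeasurableSet {z | 1 / (k + 1) * (n : ℝ) < ‖score (X n) (β₀ n) z‖} :=
      measurableSet_lt measurable_const (continuous_score (X n) (β₀ n)).norm.measurable
    simpa only [not_le, (hy n).measure_eq hmeas] using hn
  filter_upwards [ae_all_iff.2 hscore] with ω hω
  rw [isLittleO_iff_nat_mul_le]
  refine fun k => (hω k).mono fun n hn => ?_
  rw [norm_norm, Real.norm_natCast]
  rw [one_div_mul_eq_div, le_div_iff₀ (by positivity)] at hn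
  linarith [norm_nonneg (score (X n) (β₀ n) (y n ω))]

end ScoreAsymptotics

section Posterior

theorem measurable_realGamma : Measurable Real.Gamma := by
  have hpoles : (Set.range fun m : ℕ => -(m : ℝ)).Countable := Set.countable_range _
  refine measurable_of_restrict_of_restrict_compl hpoles.measurableSet ?_ ?_
  · have := hpoles.to_subtype
    exact measurable_of_countable _
  · refine (continuousOn_iff_continuous_domRestrict.1 fun s hs => ?_).measurable
    exact (Real.differentiableAt_Gamma fun m hm =>
      hs ⟨m, hm.symm⟩).continuousAt.continuousWithinAt

theorem measurable_coefPriorDensity {p : ℕ} (γ : ℝ) :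
    Measurable fun q : E p × Theta p => coefPriorDensity γ q.2.1 q.2.2.1 q.1 := by
  have hΓ := measurable_realGamma
  unfold coefPriorDensity
  fun_prop

theorem measurable_coefPriorDensity_right {p : ℕ} (γ : ℝ) (β : E p) :
    Measurable fun θ : Theta p => coefPriorDensity γ θ.1 θ.2.1 β :=
  (measurable_coefPriorDensity γ).comp measurable_prodMk_left

/-- The marginal prior density of the coefficients: `coefPriorDensity` averaged over the uniform
exponent `α`, with all scales equal to `L ^ α`. The mixture indicators `κ` do not enter. -/
noncomputable def coefPriorMarginal {p : ℕ} (γ k₁ k₂ L : ℝ) (β : E p) : ℝ≥0∞ :=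
  ∫⁻ α, ENNReal.ofReal (coefPriorDensity γ (fun _ => L ^ α) α β)
    ∂ProbabilityTheory.cond volume (Set.Icc k₁ k₂)

variable {n p : ℕ} (X : Matrix (Fin n) (Fin p) ℝ) (γ k₁ k₂ L : ℝ)

instance : SFinite (ProbabilityTheory.cond volume (Set.Icc k₁ k₂) : Measure ℝ) := by
  unfold ProbabilityTheory.cond
  infer_instance

instance : SFinite (thetaPrior p k₁ k₂ L) := by
  unfold thetaPrior
  infer_instance

theorem lintegral_coefPriorDensity_thetaPrior (β : E p) :
    ∫⁻ θ, ENNReal.ofReal (coefPriorDensity γ θ.1 θ.2.1 β) ∂thetaPrior p k₁ k₂ L =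
      coefPriorMarginal γ k₁ k₂ L β := by
  have hdens : Measurable fun θ : Theta p =>
      ENNReal.ofReal (coefPriorDensity γ θ.1 θ.2.1 β) :=
    (measurable_coefPriorDensity_right γ β).ennreal_ofReal
  rw [thetaPrior, lintegral_map hdens (by fun_prop), lintegral_prod _ ?_]
  · simp only [lintegral_const, measure_univ, mul_one, coefPriorMarginal]
  · exact (hdens.comp (by fun_prop)).aemeasurable

theorem lintegral_jointPrior_comp_fst {g : E p → ℝ≥0∞} (hg : Measurable g) :
    ∫⁻ q, g q.1 ∂jointPrior p γ k₁ k₂ L = ∫⁻ β, coefPriorMarginal γ k₁ k₂ L β * g β := by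
  have hdens : Measurable fun q : E p × Theta p =>
      ENNReal.ofReal (coefPriorDensity γ q.2.1 q.2.2.1 q.1) :=
    (measurable_coefPriorDensity γ).ennreal_ofReal
  have hg' : Measurable fun q : E p × Theta p => g q.1 := hg.comp measurable_fst
  rw [jointPrior, lintegral_withDensity_eq_lintegral_mul _ hdens hg',
    lintegral_prod _ (hdens.mul hg').aemeasurable]
  refine lintegral_congr fun β => ?_
  rw [← lintegral_coefPriorDensity_thetaPrior,
    ← lintegral_mul_const _ (measurable_coefPriorDensity_right γ β).ennreal_ofReal]
  rfl

theorem continuous_mean : Continuous (mean X) :=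
  (Matrix.toEuclideanLin X).continuous_of_finiteDimensional

theorem continuous_likelihood (y : E n) : Continuous (likelihood X γ y) := by
  have hmean := continuous_mean X
  unfold likelihood
  fun_prop

theorem marginalPosterior_apply (y : E n) {A : Set (E p)} (hA : MeasurableSet A) :
    marginalPosterior X γ k₁ k₂ L y A =
      (∫⁻ β, coefPriorMarginal γ k₁ k₂ L β * ENNReal.ofReal (likelihood X γ y β))⁻¹ *
        ∫⁻ β in A, coefPriorMarginal γ k₁ k₂ L β * ENNReal.ofReal (likelihood X γ y β) := by
  have hlik : Measurable fun β => ENNReal.ofReal (likelihood X γ y β) :=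
    (continuous_likelihood X γ y).measurable.ennreal_ofReal
  have hA' : MeasurableSet (Prod.fst ⁻¹' A : Set (E p × Theta p)) := measurable_fst hA
  rw [marginalPosterior, Measure.map_apply measurable_fst hA, jointPosterior, Measure.smul_apply,
    smul_eq_mul, withDensity_apply _ hA', lintegral_jointPrior_comp_fst γ k₁ k₂ L hlik,
    ← lintegral_indicator hA', ← lintegral_indicator hA]
  have h := lintegral_jointPrior_comp_fst γ k₁ k₂ L (hlik.indicator hA)
  simp_rw [← Set.indicator_mul_right] at h
  exact congrArg _ h

end Posterior

section PowPenalty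

theorem rpow_le_rpow_add_one {x k α : ℝ} (hx : 0 ≤ x) (hk : 0 ≤ k) (hkα : k ≤ α) :
    x ^ k ≤ x ^ α + 1 := by
  rcases le_total x 1 with h | h
  · linarith [Real.rpow_le_one hx h hk, Real.rpow_nonneg hx α]
  · linarith [Real.rpow_le_rpow_of_exponent_le h hkα]

-- For `1 ≤ x`, Bernoulli gives `x ^ α = x ^ k * x ^ (α - k) ≤ x ^ k * (1 + (α - k) * x)`.
theorem rpow_le_rpow_add_one_of_sub_le {x B k α : ℝ} (hx : 0 ≤ x) (hxB : x ≤ B) (hB : 1 ≤ B)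
    (hk : 0 ≤ k) (hk1 : k ≤ 1) (hkα : k ≤ α) (hα : α - k ≤ 1 / B ^ 2) : x ^ α ≤ x ^ k + 1 := by
  rcases le_total x 1 with h | h
  · linarith [Real.rpow_le_one hx h (hk.trans hkα), Real.rpow_nonneg hx k]
  · have hα1 : α - k ≤ 1 := hα.trans ((div_le_one₀ (by positivity)).2 (one_le_pow₀ hB))
    have hbernoulli : x ^ (α - k) ≤ 1 + (α - k) * (x - 1) := by
      simpa using rpow_one_add_le_one_add_mul_self (s := x - 1) (by linarith)
        (sub_nonneg.2 hkα) hα1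
    have hxk : x ^ k ≤ B := (Real.rpow_le_self_of_one_le h hk1).trans hxB
    calc x ^ α = x ^ k * x ^ (α - k) := by
          rw [← Real.rpow_add (one_pos.trans_le h), add_sub_cancel]
      _ ≤ x ^ k * (1 + (α - k) * (x - 1)) := by gcongr
      _ = x ^ k + x ^ k * ((α - k) * (x - 1)) := by ring
      _ ≤ x ^ k + B * (1 / B ^ 2 * B) := by
          gcongr
          linarith
      _ = x ^ k + 1 := by field_simp

/-- The power penalty `∑ (L |β_j|) ^ k`, the exponent of the coefficient prior with scale `L`. -/
noncomputable def powPenalty {p : ℕ} (L k : ℝ) (β : E p) : ℝ := ∑ i, (L * |β i|) ^ k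

variable {p : ℕ} {L k : ℝ}

theorem powPenalty_nonneg (hL : 0 ≤ L) (β : E p) : 0 ≤ powPenalty L k β :=
  Finset.sum_nonneg fun _ _ => by positivity

theorem rpow_mul_abs_add_le {a b : ℝ} (hL : 0 ≤ L) (hk : 0 ≤ k) (hk1 : k ≤ 1) :
    (L * |a + b|) ^ k ≤ (L * |a|) ^ k + (L * |b|) ^ k := by
  refine le_trans ?_ (Real.rpow_add_le_add_rpow (by positivity) (by positivity) hk hk1)
  rw [← mul_add]
  gcongr
  exact abs_add_le a b

theorem powPenalty_add_le (hL : 0 ≤ L) (hk : 0 ≤ k) (hk1 : k ≤ 1) (β h : E p) :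
    powPenalty L k (β + h) ≤ powPenalty L k β + powPenalty L k h := by
  simp only [powPenalty, ← Finset.sum_add_distrib]
  exact Finset.sum_le_sum fun i _ => rpow_mul_abs_add_le hL hk hk1

theorem card_filter_ne_zero_eq_numNonzero (β : E p) :
    (Finset.univ.filter fun i => β i ≠ 0).card = numNonzero β := by
  rw [numNonzero, Nat.card_eq_fintype_card, Fintype.card_subtype]

theorem numNonzero_le (β : E p) : numNonzero β ≤ p := by
  simpa only [card_filter_ne_zero_eq_numNonzero, Fintype.card_fin] using
    Finset.card_le_univ (Finset.univ.filter fun i => β i ≠ 0)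

theorem sum_filter_ne_zero_abs_le (β h : E p) :
    ∑ i with β i ≠ 0, |h i| ≤ √(numNonzero β) * ‖h‖ := by
  refine le_of_sq_le_sq ?_ (by positivity)
  calc (∑ i with β i ≠ 0, |h i|) ^ 2
      ≤ (Finset.univ.filter fun i => β i ≠ 0).card * ∑ i with β i ≠ 0, |h i| ^ 2 :=
        sq_sum_le_card_mul_sum_sq
    _ ≤ numNonzero β * ∑ i, |h i| ^ 2 := by
        rw [card_filter_ne_zero_eq_numNonzero]
        gcongr
        exact Finset.subset_univ _
    _ = (√(numNonzero β) * ‖h‖) ^ 2 := by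
        rw [mul_pow, Real.sq_sqrt (Nat.cast_nonneg _), EuclideanSpace.norm_sq_eq]
        rfl

-- Subadditivity is reversed exactly on the coordinates where `β` vanishes; on the others one loses
-- at most twice the penalty of `h`, which is linear in `h` up to a constant.
theorem le_powPenalty_add (hL : 0 ≤ L) (hk : 0 < k) (hk1 : k ≤ 1) (β h : E p) :
    powPenalty L k β + powPenalty L k h - 2 * (numNonzero β + L * √(numNonzero β) * ‖h‖) ≤
      powPenalty L k (β + h) := by
  have hterm : ∀ i, (L * |β i|) ^ k + (L * |h i|) ^ k -
      (if β i ≠ 0 then 2 * (1 + L * |h i|) else 0) ≤ (L * |(β + h) i|) ^ k := fun i => by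
    by_cases hi : β i = 0
    · simp [hi, Real.zero_rpow hk.ne']
    · have hrev := rpow_mul_abs_add_le (a := (β + h) i) (b := -h i) hL hk.le hk1
      have hlin := rpow_le_rpow_add_one (x := L * |h i|) (by positivity) hk.le hk1
      rw [PiLp.add_apply, add_neg_cancel_right, abs_neg, ← PiLp.add_apply] at hrev
      rw [Real.rpow_one] at hlin
      rw [if_pos hi]
      linarith
  have hsum := Finset.sum_le_sum fun i (_ : i ∈ Finset.univ) => hterm i
  rw [Finset.sum_sub_distrib, Finset.sum_add_distrib, ← Finset.sum_filter, ← Finset.mul_sum,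
    Finset.sum_add_distrib, Finset.sum_const, nsmul_one, card_filter_ne_zero_eq_numNonzero,
    ← Finset.mul_sum] at hsum
  have hsupp := mul_le_mul_of_nonneg_left (sum_filter_ne_zero_abs_le β h) hL
  simp only [powPenalty]
  linarith

theorem powPenalty_le_add_dim {k α : ℝ} {β : E p}
    (h : ∀ i, (L * |β i|) ^ k ≤ (L * |β i|) ^ α + 1) :
    powPenalty L k β ≤ powPenalty L α β + p := by
  simpa only [powPenalty, Finset.sum_add_distrib, Finset.sum_const, Finset.card_univ,
    Fintype.card_fin, nsmul_one] using Finset.sum_le_sum fun i (_ : i ∈ Finset.univ) => h i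

end PowPenalty

section MarginalPrior

variable {γ : ℝ}

/-- The normalizing constant of the one-dimensional exponential power density with exponent `α`. -/
noncomputable def priorConst (γ α : ℝ) : ℝ :=
  α * γ ^ (1 / α) / (2 ^ (1 / α + 1) * Real.Gamma (1 / α))

theorem coefPriorDensity_eq {p : ℕ} {L α : ℝ} (hL : 0 ≤ L) (hα : α ≠ 0) (β : E p) :
    coefPriorDensity γ (fun _ => L ^ α) α β =
      priorConst γ α ^ p * L ^ p * Real.exp (-(γ / 2) * powPenalty L α β) := by
  have hprod : (∏ _i : Fin p, L ^ α) ^ (1 / α) = L ^ p := by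
    rw [Finset.prod_const, Finset.card_univ, Fintype.card_fin, ← Real.rpow_natCast,
      ← Real.rpow_natCast, ← Real.rpow_mul hL, ← Real.rpow_mul hL, mul_one_div,
      mul_div_cancel_left₀ _ hα]
  have hsum : ∑ i, L ^ α * |β i| ^ α = powPenalty L α β :=
    Finset.sum_congr rfl fun i _ => (Real.mul_rpow hL (abs_nonneg _)).symm
  rw [coefPriorDensity, hprod, hsum, priorConst]

theorem priorConst_pos {α : ℝ} (hγ : 0 < γ) (hα : 0 < α) : 0 < priorConst γ α := by
  have := Real.Gamma_pos_of_pos (one_div_pos.2 hα)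
  unfold priorConst
  positivity

theorem continuousAt_priorConst {α : ℝ} (hγ : 0 < γ) (hα : 0 < α) :
    ContinuousAt (priorConst γ) α := by
  have := Real.Gamma_pos_of_pos (one_div_pos.2 hα)
  have hinv : ContinuousAt (fun a : ℝ => 1 / a) α := continuousAt_const.div continuousAt_id hα.ne'
  have hΓinv : ContinuousAt (fun a : ℝ => Real.Gamma (1 / a)) α :=
    ContinuousAt.comp (f := fun a : ℝ => 1 / a) (Real.differentiableAt_Gamma fun m =>
      ((neg_nonpos.2 m.cast_nonneg).trans_lt (one_div_pos.2 hα)).ne').continuousAt hinv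
  refine ContinuousAt.div ?_ ?_ (by positivity)
  · exact continuousAt_id.mul (continuousAt_const.rpow hinv (Or.inl hγ.ne'))
  · exact (continuousAt_const.rpow (hinv.add continuousAt_const) (Or.inl two_ne_zero)).mul hΓinv

theorem exists_priorConst_bounds {k₁ k₂ : ℝ} (hγ : 0 < γ) (hk₁ : 0 < k₁) :
    ∃ c C : ℝ, 0 < c ∧ 0 < C ∧ ∀ α ∈ Set.Icc k₁ k₂, c ≤ priorConst γ α ∧ priorConst γ α ≤ C := by
  rcases (Set.Icc k₁ k₂).eq_empty_or_nonempty with hempty | hne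
  · exact ⟨1, 1, one_pos, one_pos, by simp [hempty]⟩
  have hpos : ∀ α ∈ Set.Icc k₁ k₂, 0 < α := fun α hα => hk₁.trans_le hα.1
  have hcont : ContinuousOn (priorConst γ) (Set.Icc k₁ k₂) := fun α hα =>
    (continuousAt_priorConst hγ (hpos α hα)).continuousWithinAt
  obtain ⟨a, ha, hmin⟩ := isCompact_Icc.exists_isMinOn hne hcont
  obtain ⟨b, hb, hmax⟩ := isCompact_Icc.exists_isMaxOn hne hcont
  exact ⟨_, _, priorConst_pos hγ (hpos a ha), priorConst_pos hγ (hpos b hb),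
    fun α hα => ⟨hmin hα, hmax hα⟩⟩

theorem exists_coefPriorMarginal_le (hγ : 0 < γ) {k₁ k₂ : ℝ} (hk₁ : 0 < k₁) :
    ∃ C : ℝ, 0 < C ∧ ∀ (p : ℕ) (L : ℝ) (β : E p), 0 ≤ L →
      coefPriorMarginal γ k₁ k₂ L β ≤
        ENNReal.ofReal (C ^ p * L ^ p * Real.exp (-(γ / 2) * powPenalty L k₁ β)) := by
  obtain ⟨_, C, _, hC, hbound⟩ := exists_priorConst_bounds (k₂ := k₂) hγ hk₁
  refine ⟨C * Real.exp (γ / 2), by positivity, fun p L β hL => ?_⟩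
  have hdens : ∀ α ∈ Set.Icc k₁ k₂, coefPriorDensity γ (fun _ => L ^ α) α β ≤
      (C * Real.exp (γ / 2)) ^ p * L ^ p * Real.exp (-(γ / 2) * powPenalty L k₁ β) := fun α hα => by
    have hα₀ : 0 < α := hk₁.trans_le hα.1
    have hpen : powPenalty L k₁ β ≤ powPenalty L α β + p :=
      powPenalty_le_add_dim fun i => rpow_le_rpow_add_one (by positivity) hk₁.le hα.1
    rw [coefPriorDensity_eq hL hα₀.ne', mul_pow C, ← Real.exp_nat_mul, mul_assoc, mul_assoc,
      mul_assoc, mul_left_comm (Real.exp _), ← Real.exp_add]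
    gcongr
    · exact (priorConst_pos hγ hα₀).le
    · exact (hbound α hα).2
    · linarith [mul_le_mul_of_nonneg_left hpen (half_pos hγ).le]
  refine (lintegral_mono_ae ((ProbabilityTheory.ae_cond_mem measurableSet_Icc).mono
    fun α hα => ENNReal.ofReal_le_ofReal (hdens α hα))).trans ?_
  rw [lintegral_const]
  exact mul_le_of_le_one_right' prob_le_one

theorem cond_volume_Icc_apply {k₁ k₂ δ : ℝ} (hk : k₁ < k₂) (hδ : k₁ + δ ≤ k₂) :
    ProbabilityTheory.cond volume (Set.Icc k₁ k₂) (Set.Icc k₁ (k₁ + δ)) =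
      ENNReal.ofReal (δ / (k₂ - k₁)) := by
  rw [ProbabilityTheory.cond_apply measurableSet_Icc,
    Set.inter_eq_self_of_subset_right (Set.Icc_subset_Icc_right hδ), Real.volume_Icc,
    Real.volume_Icc, add_sub_cancel_left, ENNReal.ofReal_div_of_pos (sub_pos.2 hk),
    ENNReal.div_eq_inv_mul]

theorem exists_le_coefPriorMarginal (hγ : 0 < γ) {k₁ k₂ : ℝ} (hk₁ : 0 < k₁) (hk₁' : k₁ ≤ 1)
    (hk : k₁ < k₂) :
    ∃ κ c : ℝ, 0 < κ ∧ 0 < c ∧ ∀ (p : ℕ) (L B : ℝ) (β : E p), 0 ≤ L → 1 ≤ B →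
      (∀ i, L * |β i| ≤ B) →
        ENNReal.ofReal (κ / B ^ 2 * (c ^ p * L ^ p * Real.exp (-(γ / 2) * powPenalty L k₁ β))) ≤
          coefPriorMarginal γ k₁ k₂ L β := by
  obtain ⟨c, _, hc, _, hbound⟩ := exists_priorConst_bounds (k₂ := k₂) hγ hk₁
  have hk' : 0 < k₂ - k₁ := sub_pos.2 hk
  have hmin : 0 < min 1 (k₂ - k₁) := lt_min one_pos hk'
  refine ⟨min 1 (k₂ - k₁) / (k₂ - k₁), c * Real.exp (-(γ / 2)), by positivity, by positivity,
    fun p L B β hL hB hβ => ?_⟩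
  set δ : ℝ := min 1 (k₂ - k₁) / B ^ 2 with hδ
  have hδB : δ ≤ 1 / B ^ 2 :=
    div_le_div_of_nonneg_right (min_le_left _ _) (by positivity)
  have hδk : k₁ + δ ≤ k₂ := by
    have hle : δ ≤ min 1 (k₂ - k₁) := div_le_self hmin.le (one_le_pow₀ hB)
    linarith [min_le_right 1 (k₂ - k₁)]
  have hdens : ∀ α ∈ Set.Icc k₁ (k₁ + δ),
      (c * Real.exp (-(γ / 2))) ^ p * L ^ p * Real.exp (-(γ / 2) * powPenalty L k₁ β) ≤
        coefPriorDensity γ (fun _ => L ^ α) α β := fun α hα => by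
    have hpen : powPenalty L α β ≤ powPenalty L k₁ β + p :=
      powPenalty_le_add_dim fun i => rpow_le_rpow_add_one_of_sub_le (by positivity) (hβ i) hB
        hk₁.le hk₁' hα.1 (by linarith [hα.2])
    rw [coefPriorDensity_eq hL (hk₁.trans_le hα.1).ne', mul_pow c, ← Real.exp_nat_mul, mul_assoc,
      mul_assoc, mul_assoc, mul_left_comm (Real.exp _), ← Real.exp_add]
    gcongr
    · exact pow_nonneg (priorConst_pos hγ (hk₁.trans_le hα.1)).le p
    · exact (hbound α ⟨hα.1, hα.2.trans hδk⟩).1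
    · linarith [mul_le_mul_of_nonneg_left hpen (half_pos hγ).le]
  refine le_trans ?_ ((setLIntegral_mono' measurableSet_Icc fun α hα =>
    ENNReal.ofReal_le_ofReal (hdens α hα)).trans
    (setLIntegral_le_lintegral (Set.Icc k₁ (k₁ + δ)) _))
  rw [setLIntegral_const, cond_volume_Icc_apply hk hδk, ← ENNReal.ofReal_mul (by positivity),
    mul_comm, hδ, div_right_comm]

end MarginalPrior

section Integrals

variable {p : ℕ} {b c k L M : ℝ}

theorem integral_exp_neg_mul_abs_rpow_pos (hb : 0 < b) (hk : 0 < k) :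
    0 < ∫ t : ℝ, Real.exp (-b * |t| ^ k) := by
  rw [integral_comp_abs (f := fun t => Real.exp (-b * t ^ k)), integral_exp_neg_mul_rpow hk hb]
  have := Real.Gamma_pos_of_pos (show 0 < 1 / k + 1 by positivity)
  positivity

theorem integrable_exp_neg_mul_abs_rpow (hb : 0 < b) (hk : 0 < k) :
    Integrable fun t : ℝ => Real.exp (-b * |t| ^ k) :=
  .of_integral_ne_zero (integral_exp_neg_mul_abs_rpow_pos hb hk).ne'

theorem lintegral_exp_neg_powPenalty (hb : 0 < b) (hk : 0 < k) (hL : 0 < L) :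
    ∫⁻ h : E p, ENNReal.ofReal (Real.exp (-b * powPenalty L k h)) =
      ENNReal.ofReal (((∫ t : ℝ, Real.exp (-b * |t| ^ k)) / L) ^ p) := by
  set f : ℝ → ℝ := fun t => Real.exp (-b * |L * t| ^ k) with hf
  have hprod : ∀ h : E p, Real.exp (-b * powPenalty L k h) = ∏ i, f (h i) := fun h => by
    simp only [hf, powPenalty, Finset.mul_sum, Real.exp_sum, abs_mul, abs_of_pos hL]
  have hint : Integrable f := (integrable_exp_neg_mul_abs_rpow hb hk).comp_mul_left' hL.ne'
  have hint' : Integrable fun x : Fin p → ℝ => ∏ i, f (x i) := .fintype_prod fun _ => hint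
  have hval : ∫ t, f t = (∫ t : ℝ, Real.exp (-b * |t| ^ k)) / L := by
    rw [hf, Measure.integral_comp_mul_left (fun t : ℝ => Real.exp (-b * |t| ^ k)),
      abs_of_pos (inv_pos.2 hL), smul_eq_mul, div_eq_inv_mul]
  simp_rw [hprod]
  rw [(PiLp.volume_preserving_ofLp (Fin p)).lintegral_comp_emb
      (MeasurableEquiv.toLp 2 (Fin p → ℝ)).symm.measurableEmbedding
      (fun x : Fin p → ℝ => ENNReal.ofReal (∏ i, f (x i))),
    ← ofReal_integral_eq_lintegral_ofReal hint'
      (ae_of_all _ fun x => Finset.prod_nonneg fun i _ => (Real.exp_pos _).le),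
    integral_fintype_prod_volume_eq_prod (𝕜 := ℝ) fun (_ : Fin p) => f, Finset.prod_const, hval,
    Finset.card_univ, Fintype.card_fin]

theorem lintegral_exp_neg_mul_sq_mul_norm (hc : 0 < c) (hM : 0 < M) :
    ∫⁻ h : E p, ENNReal.ofReal (Real.exp (-c * (M * ‖h‖) ^ 2)) =
      ENNReal.ofReal ((√(Real.pi / c) / M) ^ p) := by
  have hgauss := lintegral_exp_neg_mul_sq_norm_add_inner (V := E p) (b := c * M ^ 2)
    (by positivity) 0
  have hconst : (Real.pi / (c * M ^ 2)) ^ ((p : ℝ) / 2) = (√(Real.pi / c) / M) ^ p := by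
    rw [← Real.sqrt_sq hM.le, ← Real.sqrt_div' _ (sq_nonneg M), Real.sqrt_sq hM.le, div_div,
      Real.sqrt_eq_rpow, ← Real.rpow_mul_natCast (by positivity), one_div_mul_eq_div]
  simpa only [inner_zero_left, add_zero, norm_zero, zero_pow two_ne_zero, zero_div, Real.exp_zero,
    mul_one, finrank_euclideanSpace_fin, hconst, mul_pow, ← mul_assoc, neg_mul] using hgauss

theorem exists_lintegral_exp_neg_powPenalty_add_le (hb : 0 < b) (hc : 0 < c) (hk : 0 < k) :
    ∃ K : ℝ, 0 < K ∧ ∀ (p : ℕ) (L M : ℝ), 0 < L → 0 < M →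
      ∫⁻ h : E p, ENNReal.ofReal (Real.exp (-b * powPenalty L k h + -c * (M * ‖h‖) ^ 2)) ≤
        ENNReal.ofReal ((K / max L M) ^ p) := by
  set I := ∫ t : ℝ, Real.exp (-b * |t| ^ k)
  have hI : 0 < I := integral_exp_neg_mul_abs_rpow_pos hb hk
  refine ⟨max I √(Real.pi / c), lt_max_of_lt_left hI, fun p L M hL hM => ?_⟩
  rcases max_choice L M with h | h <;> rw [h]
  · calc ∫⁻ h : E p, ENNReal.ofReal (Real.exp (-b * powPenalty L k h + -c * (M * ‖h‖) ^ 2))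
        ≤ ∫⁻ h : E p, ENNReal.ofReal (Real.exp (-b * powPenalty L k h)) := by
          gcongr with h
          exact add_le_of_nonpos_right (mul_nonpos_of_nonpos_of_nonneg (by linarith) (sq_nonneg _))
      _ = ENNReal.ofReal ((I / L) ^ p) := lintegral_exp_neg_powPenalty hb hk hL
      _ ≤ ENNReal.ofReal ((max I √(Real.pi / c) / L) ^ p) := by
          gcongr
          exact le_max_left _ _
  · calc ∫⁻ h : E p, ENNReal.ofReal (Real.exp (-b * powPenalty L k h + -c * (M * ‖h‖) ^ 2))
        ≤ ∫⁻ h : E p, ENNReal.ofReal (Real.exp (-c * (M * ‖h‖) ^ 2)) := by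
          gcongr with h
          exact add_le_of_nonpos_left (mul_nonpos_of_nonpos_of_nonneg (by linarith)
            (powPenalty_nonneg hL.le h))
      _ = ENNReal.ofReal ((√(Real.pi / c) / M) ^ p) := lintegral_exp_neg_mul_sq_mul_norm hc hM
      _ ≤ ENNReal.ofReal ((max I √(Real.pi / c) / M) ^ p) := by
          gcongr
          exact le_max_right _ _

theorem measurableSet_box (β : E p) (r : ℝ) : MeasurableSet {x : E p | ∀ i, |x i - β i| ≤ r} := by
  measurability

theorem volume_box (β : E p) (r : ℝ) :
    volume {x : E p | ∀ i, |x i - β i| ≤ r} = ENNReal.ofReal (2 * r) ^ p := by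
  have hbox : {x : E p | ∀ i, |x i - β i| ≤ r} =
      WithLp.ofLp ⁻¹' (Set.univ.pi fun i => Metric.closedBall (β i) r) := by
    ext x
    simp [Real.dist_eq]
  have hmeas : MeasurableSet (Set.univ.pi fun i => Metric.closedBall (β i) r) :=
    MeasurableSet.univ_pi fun i => measurableSet_closedBall
  rw [hbox, (PiLp.volume_preserving_ofLp (Fin p)).measure_preimage hmeas.nullMeasurableSet,
    volume_pi_pi]
  simp

theorem sq_norm_le_of_abs_le {r : ℝ} {h : E p} (hh : ∀ i, |h i| ≤ r) : ‖h‖ ^ 2 ≤ p * r ^ 2 := by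
  calc ‖h‖ ^ 2 = ∑ i, |h i| ^ 2 := EuclideanSpace.norm_sq_eq h
    _ ≤ ∑ _i : Fin p, r ^ 2 := Finset.sum_le_sum fun i _ => by gcongr; exact hh i
    _ = p * r ^ 2 := by
        rw [Finset.sum_const, Finset.card_univ, Fintype.card_fin, nsmul_eq_mul]

end Integrals

section PenalizedLoss

variable {n p : ℕ} {X : Matrix (Fin n) (Fin p) ℝ} {y : E n} {β h : E p}
  {γ L M k s D τ ε : ℝ}

/-- The penalized least squares criterion `‖y - X β‖ ^ 2 + powPenalty L k β`. -/
noncomputable def penalizedLoss (X : Matrix (Fin n) (Fin p) ℝ) (L k : ℝ) (y : E n) (β : E p) : ℝ :=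
  ‖y - mean X β‖ ^ 2 + powPenalty L k β

/-- The likelihood times the unnormalized prior density with exponent fixed at `k`. It serves as the
common reference for the numerator and the denominator of the posterior. -/
noncomputable def penalizedWeight (X : Matrix (Fin n) (Fin p) ℝ) (γ L k : ℝ) (y : E n) (β : E p) :
    ℝ :=
  (γ / (2 * Real.pi)) ^ ((n : ℝ) / 2) * L ^ p * Real.exp (-(γ / 2) * penalizedLoss X L k y β)

theorem pow_mul_exp_neg_powPenalty_mul_likelihood (a : ℝ) :
    a * L ^ p * Real.exp (-(γ / 2) * powPenalty L k β) * likelihood X γ y β =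
      a * penalizedWeight X γ L k y β := by
  rw [penalizedWeight, penalizedLoss, likelihood, mul_add, Real.exp_add]
  ring

theorem penalizedWeight_pos (hγ : 0 < γ) (hL : 0 < L) : 0 < penalizedWeight X γ L k y β := by
  unfold penalizedWeight
  positivity

theorem penalizedWeight_eq_mul_exp_sub (β' : E p) :
    penalizedWeight X γ L k y β' = penalizedWeight X γ L k y β *
      Real.exp (-(γ / 2) * (penalizedLoss X L k y β' - penalizedLoss X L k y β)) := by
  rw [penalizedWeight, penalizedWeight, mul_assoc _ (Real.exp _), ← Real.exp_add, ← mul_add,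
    add_sub_cancel]

theorem penalizedLoss_add_sub (X : Matrix (Fin n) (Fin p) ℝ) (L k : ℝ) (y : E n) (β h : E p) :
    penalizedLoss X L k y (β + h) - penalizedLoss X L k y β =
      powPenalty L k (β + h) - powPenalty L k β +
        (‖mean X h‖ ^ 2 - 2 * inner ℝ (score X β y) h) := by
  have hmean : mean X (β + h) = mean X β + mean X h := map_add (Matrix.toEuclideanLin X) β h
  rw [penalizedLoss, penalizedLoss, hmean, inner_score, ← sub_sub y,
    norm_sub_sq_real (y - mean X β)]
  ring

theorem le_penalizedLoss_add_sub (hL : 0 ≤ L) (hk : 0 < k) (hk1 : k ≤ 1) (hs : 0 ≤ s)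
    (hM : 0 ≤ M) (hX : s * (M * ‖h‖) ^ 2 ≤ ‖mean X h‖ ^ 2) (hτ : ‖score X β y‖ ≤ τ) (hε : 0 ≤ ε)
    (hh : ε < ‖h‖) (hfar : 2 * τ * ‖h‖ + 2 * (numNonzero β + L * √(numNonzero β) * ‖h‖) ≤
      s / 2 * (M * ‖h‖) ^ 2) :
    powPenalty L k h + s / 4 * (M * ‖h‖) ^ 2 + s / 4 * (M * ε) ^ 2 ≤
      penalizedLoss X L k y (β + h) - penalizedLoss X L k y β := by
  have hpen := le_powPenalty_add hL hk hk1 β h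
  have hinner : inner ℝ (score X β y) h ≤ τ * ‖h‖ :=
    (real_inner_le_norm _ _).trans (mul_le_mul_of_nonneg_right hτ (norm_nonneg h))
  have hεh : s / 4 * (M * ε) ^ 2 ≤ s / 4 * (M * ‖h‖) ^ 2 := by gcongr
  rw [penalizedLoss_add_sub]
  linarith

theorem penalizedWeight_add_le (hγ : 0 < γ) (hL : 0 < L) (hk : 0 < k) (hk1 : k ≤ 1) (hs : 0 ≤ s)
    (hM : 0 ≤ M) (hX : s * (M * ‖h‖) ^ 2 ≤ ‖mean X h‖ ^ 2) (hτ : ‖score X β y‖ ≤ τ) (hε : 0 ≤ ε)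
    (hh : ε < ‖h‖) (hfar : 2 * τ * ‖h‖ + 2 * (numNonzero β + L * √(numNonzero β) * ‖h‖) ≤
      s / 2 * (M * ‖h‖) ^ 2) :
    penalizedWeight X γ L k y (β + h) ≤
      penalizedWeight X γ L k y β * Real.exp (-(γ / 8 * s * (M * ε) ^ 2)) *
        Real.exp (-(γ / 2) * powPenalty L k h + -(γ / 8 * s) * (M * ‖h‖) ^ 2) := by
  have hloss := le_penalizedLoss_add_sub hL.le hk hk1 hs hM hX hτ hε hh hfar
  have hW : 0 < penalizedWeight X γ L k y β := penalizedWeight_pos hγ hL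
  rw [penalizedWeight_eq_mul_exp_sub (β := β), mul_assoc, ← Real.exp_add]
  gcongr
  linarith [mul_le_mul_of_nonneg_left hloss (half_pos hγ).le]

theorem powPenalty_le_dim (hL : 0 ≤ L) (hk : 0 ≤ k) (hh : ∀ i, L * |h i| ≤ 1) :
    powPenalty L k h ≤ p :=
  calc powPenalty L k h ≤ ∑ _i : Fin p, (1 : ℝ) :=
        Finset.sum_le_sum fun i _ => Real.rpow_le_one (by positivity) (hh i) hk
    _ = p := by simp

theorem penalizedLoss_add_sub_le (hL : 0 ≤ L) (hk : 0 ≤ k) (hk1 : k ≤ 1) (hD : 0 ≤ D) (hM : 0 < M)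
    (hp : p ≤ M ^ 2) (hX : ‖mean X h‖ ^ 2 ≤ D * (M * ‖h‖) ^ 2) (hτ : ‖score X β y‖ ≤ τ)
    (hh : ∀ i, |h i| ≤ 1 / max L M) :
    penalizedLoss X L k y (β + h) - penalizedLoss X L k y β ≤ (1 + D) * p + 2 * τ := by
  have hT : 0 < max L M := lt_max_of_lt_right hM
  have hτ₀ : 0 ≤ τ := (norm_nonneg _).trans hτ
  have hpen : powPenalty L k (β + h) ≤ powPenalty L k β + p :=
    (powPenalty_add_le hL hk hk1 β h).trans <| add_le_add_right (powPenalty_le_dim hL hk fun i =>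
      (mul_le_mul_of_nonneg_left (hh i) hL).trans <| by
        rw [mul_one_div]
        exact div_le_one_of_le₀ (le_max_left L M) hT.le) _
  have hMh : (M * ‖h‖) ^ 2 ≤ p :=
    calc (M * ‖h‖) ^ 2 = M ^ 2 * ‖h‖ ^ 2 := mul_pow _ _ _
      _ ≤ max L M ^ 2 * (p * (1 / max L M) ^ 2) := by
          gcongr
          · exact le_max_right L M
          · exact sq_norm_le_of_abs_le hh
      _ = p := by field_simp
  have hnorm : ‖h‖ ≤ 1 := by
    have hle : M * ‖h‖ ≤ M * 1 := by
      rw [mul_one]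
      exact le_of_sq_le_sq (hMh.trans hp) hM.le
    exact le_of_mul_le_mul_left hle hM
  have hinner : -inner ℝ (score X β y) h ≤ τ :=
    calc -inner ℝ (score X β y) h ≤ ‖score X β y‖ * ‖h‖ :=
          (neg_le_abs _).trans (abs_real_inner_le_norm _ _)
      _ ≤ τ * 1 := by gcongr
      _ = τ := mul_one τ
  have hmean : ‖mean X h‖ ^ 2 ≤ D * p := hX.trans (by gcongr)
  rw [penalizedLoss_add_sub]
  linarith

theorem le_penalizedWeight_add (hγ : 0 < γ) (hL : 0 < L) (hk : 0 ≤ k) (hk1 : k ≤ 1) (hD : 0 ≤ D)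
    (hM : 0 < M) (hp : p ≤ M ^ 2) (hX : ‖mean X h‖ ^ 2 ≤ D * (M * ‖h‖) ^ 2)
    (hτ : ‖score X β y‖ ≤ τ) (hh : ∀ i, |h i| ≤ 1 / max L M) :
    penalizedWeight X γ L k y β * (Real.exp (-(γ / 2 * (1 + D))) ^ p * Real.exp (-(γ * τ))) ≤
      penalizedWeight X γ L k y (β + h) := by
  have hloss := penalizedLoss_add_sub_le hL.le hk hk1 hD hM hp hX hτ hh
  have hW : 0 < penalizedWeight X γ L k y β := penalizedWeight_pos hγ hL
  rw [penalizedWeight_eq_mul_exp_sub (β := β) (β + h), ← Real.exp_nat_mul, ← Real.exp_add]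
  gcongr
  linarith [mul_le_mul_of_nonneg_left hloss (half_pos hγ).le]

theorem mul_abs_add_le_add_one (hL : 0 < L) {i : Fin p} (hh : |h i| ≤ 1 / max L M) :
    L * |(β + h) i| ≤ L * |β i| + 1 := by
  have hT : 0 < max L M := lt_max_of_lt_left hL
  calc L * |(β + h) i| ≤ L * |β i| + L * |h i| := by
        rw [← mul_add]
        gcongr
        exact abs_add_le (β i) (h i)
    _ ≤ L * |β i| + max L M * (1 / max L M) := by gcongr; exact le_max_left L M
    _ = L * |β i| + 1 := by rw [mul_one_div_cancel hT.ne']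

end PenalizedLoss

section PosteriorBound

variable {γ k₁ k₂ : ℝ}

theorem exists_prior_mul_likelihood_le (hγ : 0 < γ) (hk₁ : 0 < k₁) :
    ∃ C : ℝ, 0 < C ∧ ∀ {n p : ℕ} (X : Matrix (Fin n) (Fin p) ℝ) (y : E n) (β : E p) {L : ℝ},
      0 ≤ L → coefPriorMarginal γ k₁ k₂ L β * ENNReal.ofReal (likelihood X γ y β) ≤
        ENNReal.ofReal (C ^ p * penalizedWeight X γ L k₁ y β) := by
  obtain ⟨C, hC, hprior⟩ := exists_coefPriorMarginal_le (k₂ := k₂) hγ hk₁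
  refine ⟨C, hC, fun {n p} X y β {L} hL => ?_⟩
  refine (mul_le_mul_left (hprior p L β hL) _).trans_eq ?_
  rw [← ENNReal.ofReal_mul (by positivity), pow_mul_exp_neg_powPenalty_mul_likelihood]

theorem exists_le_prior_mul_likelihood (hγ : 0 < γ) (hk₁ : 0 < k₁) (hk₁' : k₁ ≤ 1)
    (hk : k₁ < k₂) :
    ∃ κ c : ℝ, 0 < κ ∧ 0 < c ∧ ∀ {n p : ℕ} (X : Matrix (Fin n) (Fin p) ℝ) (y : E n) {β : E p}
      {L B : ℝ}, 0 ≤ L → 1 ≤ B → (∀ i, L * |β i| ≤ B) →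
      ENNReal.ofReal (κ / B ^ 2 * (c ^ p * penalizedWeight X γ L k₁ y β)) ≤
        coefPriorMarginal γ k₁ k₂ L β * ENNReal.ofReal (likelihood X γ y β) := by
  obtain ⟨κ, c, hκ, hc, hprior⟩ := exists_le_coefPriorMarginal hγ hk₁ hk₁' hk
  refine ⟨κ, c, hκ, hc, fun {n p} X y {β L B} hL hB hβ => ?_⟩
  refine le_trans (le_of_eq ?_) (mul_le_mul_left (hprior p L B β hL hB hβ) _)
  rw [← ENNReal.ofReal_mul (by positivity), mul_assoc (κ / _),
    pow_mul_exp_neg_powPenalty_mul_likelihood]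

theorem exists_setLIntegral_prior_mul_likelihood_le (hγ : 0 < γ) (hk₁ : 0 < k₁) (hk₁' : k₁ ≤ 1)
    {s : ℝ} (hs : 0 < s) :
    ∃ A : ℝ, 0 < A ∧ ∀ {n p : ℕ} {X : Matrix (Fin n) (Fin p) ℝ} {y : E n} {β₀ : E p}
      {L M τ ε : ℝ}, 0 < L → 0 < M → (∀ h, s * (M * ‖h‖) ^ 2 ≤ ‖mean X h‖ ^ 2) →
      ‖score X β₀ y‖ ≤ τ → 0 ≤ ε →
      (∀ r, ε < r → 2 * τ * r + 2 * (numNonzero β₀ + L * √(numNonzero β₀) * r) ≤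
        s / 2 * (M * r) ^ 2) →
      ∫⁻ β in {β | ε < ‖β - β₀‖},
          coefPriorMarginal γ k₁ k₂ L β * ENNReal.ofReal (likelihood X γ y β) ≤
        ENNReal.ofReal ((A / max L M) ^ p * (penalizedWeight X γ L k₁ y β₀ *
          Real.exp (-(γ / 8 * s * (M * ε) ^ 2)))) := by
  obtain ⟨C, hC, hprior⟩ := exists_prior_mul_likelihood_le (k₂ := k₂) hγ hk₁
  obtain ⟨K, hK, hint⟩ := exists_lintegral_exp_neg_powPenalty_add_le (b := γ / 2)
    (c := γ / 8 * s) (by positivity) (by positivity) hk₁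
  refine ⟨C * K, by positivity, ?_⟩
  intro n p X y β₀ L M τ ε hL hM hX hτ hε hfar
  set W := penalizedWeight X γ L k₁ y β₀
  have hW₀ : 0 < W := penalizedWeight_pos hγ hL
  set a := C ^ p * (W * Real.exp (-(γ / 8 * s * (M * ε) ^ 2))) with ha
  have hpoint : ∀ β ∈ {β | ε < ‖β - β₀‖},
      coefPriorMarginal γ k₁ k₂ L β * ENNReal.ofReal (likelihood X γ y β) ≤
        ENNReal.ofReal a * ENNReal.ofReal (Real.exp (-(γ / 2) * powPenalty L k₁ (β - β₀) +
          -(γ / 8 * s) * (M * ‖β - β₀‖) ^ 2)) := fun β hβ => by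
    have hweight := penalizedWeight_add_le hγ hL hk₁ hk₁' hs.le hM.le (hX (β - β₀)) hτ hε hβ
      (hfar _ hβ)
    rw [add_sub_cancel] at hweight
    refine (hprior X y β hL.le).trans ?_
    rw [← ENNReal.ofReal_mul (by positivity), ha, mul_assoc (C ^ p)]
    gcongr
  calc _ ≤ ∫⁻ β, ENNReal.ofReal a * ENNReal.ofReal
        (Real.exp (-(γ / 2) * powPenalty L k₁ (β - β₀) + -(γ / 8 * s) * (M * ‖β - β₀‖) ^ 2)) :=
        (setLIntegral_mono' (measurableSet_lt measurable_const (by fun_prop)) hpoint).trans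
          (setLIntegral_le_lintegral _ _)
    _ = ENNReal.ofReal a * ∫⁻ h : E p, ENNReal.ofReal
        (Real.exp (-(γ / 2) * powPenalty L k₁ h + -(γ / 8 * s) * (M * ‖h‖) ^ 2)) := by
        rw [lintegral_const_mul' _ _ ENNReal.ofReal_ne_top, lintegral_sub_right_eq_self
          (fun h : E p => ENNReal.ofReal
            (Real.exp (-(γ / 2) * powPenalty L k₁ h + -(γ / 8 * s) * (M * ‖h‖) ^ 2)))]
    _ ≤ ENNReal.ofReal a * ENNReal.ofReal ((K / max L M) ^ p) := by
        gcongr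
        exact hint p L M hL hM
    _ = _ := by
        rw [← ENNReal.ofReal_mul (by positivity), ha, mul_div_assoc, mul_pow C]
        congr 1
        ring

theorem exists_le_lintegral_prior_mul_likelihood (hγ : 0 < γ) (hk₁ : 0 < k₁) (hk₁' : k₁ ≤ 1)
    (hk : k₁ < k₂) {D : ℝ} (hD : 0 ≤ D) :
    ∃ κ a : ℝ, 0 < κ ∧ 0 < a ∧ ∀ {n p : ℕ} {X : Matrix (Fin n) (Fin p) ℝ} {y : E n} {β₀ : E p}
      {L M τ B : ℝ}, 0 < L → 0 < M → p ≤ M ^ 2 → (∀ h, ‖mean X h‖ ^ 2 ≤ D * (M * ‖h‖) ^ 2) →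
      ‖score X β₀ y‖ ≤ τ → 1 ≤ B → (∀ i, L * |β₀ i| ≤ B) →
      ENNReal.ofReal (κ / B ^ 2 * ((a / max L M) ^ p * (penalizedWeight X γ L k₁ y β₀ *
          Real.exp (-(γ * τ))))) ≤
        ∫⁻ β, coefPriorMarginal γ k₁ k₂ L β * ENNReal.ofReal (likelihood X γ y β) := by
  obtain ⟨κ, c, hκ, hc, hprior⟩ := exists_le_prior_mul_likelihood hγ hk₁ hk₁' hk
  refine ⟨κ / 4, c * Real.exp (-(γ / 2 * (1 + D))) * 2, by positivity, by positivity, ?_⟩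
  intro n p X y β₀ L M τ B hL hM hp hX hτ hB hβ₀
  set W := penalizedWeight X γ L k₁ y β₀
  have hW₀ : 0 < W := penalizedWeight_pos hγ hL
  have : 0 < max L M := lt_max_of_lt_left hL
  set a := κ / (2 * B) ^ 2 *
    (c ^ p * (W * (Real.exp (-(γ / 2 * (1 + D))) ^ p * Real.exp (-(γ * τ))))) with ha
  have hpoint : ∀ β ∈ {β | ∀ i, |β i - β₀ i| ≤ 1 / max L M}, ENNReal.ofReal a ≤
      coefPriorMarginal γ k₁ k₂ L β * ENNReal.ofReal (likelihood X γ y β) := fun β hβ => by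
    have hweight := le_penalizedWeight_add (h := β - β₀) hγ hL hk₁.le hk₁' hD hM hp
      (hX (β - β₀)) hτ hβ
    have hβB : ∀ i, L * |β i| ≤ 2 * B := fun i => by
      have hi := mul_abs_add_le_add_one (β := β₀) (h := β - β₀) (M := M) hL (hβ i)
      rw [add_sub_cancel] at hi
      linarith [hβ₀ i]
    rw [add_sub_cancel] at hweight
    refine le_trans ?_ (hprior X y hL.le (by linarith) hβB)
    rw [ha]
    gcongr
  calc _ = ENNReal.ofReal a * volume {β : E p | ∀ i, |β i - β₀ i| ≤ 1 / max L M} := by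
        rw [volume_box, ← ENNReal.ofReal_pow (by positivity), ← ENNReal.ofReal_mul (by positivity),
          ha, mul_one_div, mul_div_assoc, mul_pow _ (2 / max L M), mul_pow c]
        congr 1
        ring
    _ ≤ ∫⁻ β in {β | ∀ i, |β i - β₀ i| ≤ 1 / max L M},
        coefPriorMarginal γ k₁ k₂ L β * ENNReal.ofReal (likelihood X γ y β) := by
        rw [← setLIntegral_const]
        exact setLIntegral_mono' (measurableSet_box _ _) hpoint
    _ ≤ _ := setLIntegral_le_lintegral _ _

theorem exists_marginalPosterior_le (hγ : 0 < γ) (hk₁ : 0 < k₁) (hk₁' : k₁ ≤ 1) (hk : k₁ < k₂)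
    {σ S : ℝ} (hσ : 0 < σ) :
    ∃ A C : ℝ, ∀ {n p : ℕ} {X : Matrix (Fin n) (Fin p) ℝ} {y : E n} {β₀ : E p} {L M τ ε b : ℝ},
      0 < L → 0 < M → p ≤ M ^ 2 → (∀ h, σ * M * ‖h‖ ≤ ‖mean X h‖) →
      (∀ h, ‖mean X h‖ ≤ S * M * ‖h‖) → ‖score X β₀ y‖ ≤ τ → 0 ≤ ε →
      (∀ r, ε < r → 2 * τ * r + 2 * (numNonzero β₀ + L * √(numNonzero β₀) * r) ≤
        σ ^ 2 / 2 * (M * r) ^ 2) →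
      (∀ i, L * |β₀ i| ≤ Real.exp b) →
      marginalPosterior X γ k₁ k₂ L y {β | ε < ‖β - β₀‖} ≤
        ENNReal.ofReal (A * Real.exp (2 * |b| + C * p + γ * τ - γ / 8 * σ ^ 2 * (M * ε) ^ 2)) := by
  obtain ⟨A, hA, hfar⟩ := exists_setLIntegral_prior_mul_likelihood_le (k₂ := k₂) hγ hk₁ hk₁'
    (s := σ ^ 2) (by positivity)
  obtain ⟨κ, a, hκ, ha, hnear⟩ := exists_le_lintegral_prior_mul_likelihood hγ hk₁ hk₁' hk
    (sq_nonneg S)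
  refine ⟨κ⁻¹, Real.log (A / a), ?_⟩
  intro n p X y β₀ L M τ ε b hL hM hp hXl hXu hτ hε hεr hβ₀
  have hW : 0 < penalizedWeight X γ L k₁ y β₀ := penalizedWeight_pos hγ hL
  have : 0 < max L M := lt_max_of_lt_left hL
  have hXl' : ∀ h, σ ^ 2 * (M * ‖h‖) ^ 2 ≤ ‖mean X h‖ ^ 2 := fun h => by
    rw [← mul_pow, ← mul_assoc]
    exact pow_le_pow_left₀ (by positivity) (hXl h) 2
  have hXu' : ∀ h, ‖mean X h‖ ^ 2 ≤ S ^ 2 * (M * ‖h‖) ^ 2 := fun h => by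
    rw [← mul_pow, ← mul_assoc]
    exact pow_le_pow_left₀ (norm_nonneg _) (hXu h) 2
  have hβ₀' : ∀ i, L * |β₀ i| ≤ Real.exp |b| := fun i =>
    (hβ₀ i).trans (Real.exp_le_exp.2 (le_abs_self b))
  have hpow : Real.exp (Real.log (A / a) * p) * (a / max L M) ^ p = (A / max L M) ^ p := by
    rw [mul_comm (Real.log _), Real.exp_nat_mul, Real.exp_log (by positivity), ← mul_pow]
    field_simp
  have hexp : Real.exp (2 * |b|) = Real.exp |b| ^ 2 := Real.exp_nat_mul _ 2
  rw [marginalPosterior_apply X γ k₁ k₂ L y (measurableSet_lt measurable_const (by fun_prop))]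
  refine (mul_le_mul' (ENNReal.inv_le_inv.2
    (hnear hL hM hp hXu' hτ (Real.one_le_exp (abs_nonneg b)) hβ₀'))
    (hfar hL hM hXl' hτ hε hεr)).trans_eq ?_
  rw [← ENNReal.ofReal_inv_of_pos (by positivity), ← ENNReal.ofReal_mul (by positivity),
    sub_eq_add_neg, Real.exp_add, Real.exp_add, Real.exp_add, Real.exp_neg (γ * τ), ← hpow, hexp]
  congr 1
  field_simp

end PosteriorBound

section Asymptotics

variable {p : ℕ → ℕ} {X : (n : ℕ) → Matrix (Fin n) (Fin (p n)) ℝ}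

theorem eventually_mul_sqrt_mul_norm_le_norm_mean
    (hp : (fun n => (p n : ℝ)) =o[atTop] (fun n : ℕ => (n : ℝ))) {Λ : ℝ}
    (hΛ : (Λ : EReal) < liminf (fun n : ℕ => ((sigmaMin (X n) / √(n : ℝ) : ℝ) : EReal)) atTop) :
    ∀ᶠ n : ℕ in atTop, ∀ h, Λ * √(n : ℝ) * ‖h‖ ≤ ‖mean (X n) h‖ := by
  filter_upwards [eventually_lt_of_lt_liminf hΛ, hp.def one_pos, eventually_gt_atTop 0]
    with n hn hpn hn₀ h
  have hsqrt : (0 : ℝ) < √n := Real.sqrt_pos.2 (Nat.cast_pos.2 hn₀)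
  rw [Real.norm_natCast, Real.norm_natCast, one_mul, Nat.cast_le] at hpn
  refine le_trans ?_ (sigmaMin_mul_norm_le (X n) hpn h)
  gcongr
  exact ((lt_div_iff₀ hsqrt).1 (EReal.coe_lt_coe_iff.1 hn)).le

theorem eventually_norm_mean_le_mul_sqrt_mul_norm {Λ : ℝ}
    (hΛ : limsup (fun n : ℕ => ((sigmaMax (X n) / √(n : ℝ) : ℝ) : EReal)) atTop < (Λ : EReal)) :
    ∀ᶠ n : ℕ in atTop, ∀ h, ‖mean (X n) h‖ ≤ Λ * √(n : ℝ) * ‖h‖ := by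
  filter_upwards [eventually_lt_of_limsup_lt hΛ, eventually_gt_atTop 0] with n hn hn₀ h
  have hsqrt : (0 : ℝ) < √n := Real.sqrt_pos.2 (Nat.cast_pos.2 hn₀)
  refine (norm_mean_le (X n) h).trans ?_
  gcongr
  exact ((div_lt_iff₀ hsqrt).1 (EReal.coe_lt_coe_iff.1 hn)).le

theorem pos_of_limsup_sigmaMax_lt {Λ : ℝ}
    (hΛ : limsup (fun n : ℕ => ((sigmaMax (X n) / √(n : ℝ) : ℝ) : EReal)) atTop < (Λ : EReal)) :
    0 < Λ := by
  obtain ⟨n, hn⟩ := (eventually_lt_of_limsup_lt hΛ).exists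
  exact (div_nonneg (LinearMap.singularValues_nonneg _ _) (Real.sqrt_nonneg _)).trans_lt
    (EReal.coe_lt_coe_iff.1 hn)

theorem eventually_forall_lt_mul_add_le {u v : ℕ → ℝ} {ε s : ℝ}
    (hu : u =o[atTop] (fun n : ℕ => (n : ℝ))) (hv : v =o[atTop] (fun n : ℕ => (n : ℝ)))
    (hε : 0 < ε) (hs : 0 < s) :
    ∀ᶠ n : ℕ in atTop, ∀ r, ε < r → u n * r + v n ≤ s * (√(n : ℝ) * r) ^ 2 := by
  filter_upwards [hu.def (show 0 < s * ε / 2 by positivity),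
    hv.def (show 0 < s * ε ^ 2 / 2 by positivity)] with n hun hvn r hr
  have hr₀ : 0 < r := hε.trans hr
  rw [Real.norm_natCast] at hun hvn
  calc u n * r + v n ≤ s * ε / 2 * n * r + s * ε ^ 2 / 2 * n := by
        gcongr
        · exact (le_abs_self _).trans hun
        · exact (le_abs_self _).trans hvn
    _ ≤ s * r / 2 * n * r + s * r ^ 2 / 2 * n := by gcongr
    _ = s * (√(n : ℝ) * r) ^ 2 := by
        rw [mul_pow, Real.sq_sqrt n.cast_nonneg]
        ring

theorem tendsto_exp_sub_mul_of_isLittleO {u : ℕ → ℝ} {c : ℝ}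
    (hu : u =o[atTop] (fun n : ℕ => (n : ℝ))) (hc : 0 < c) :
    Tendsto (fun n : ℕ => Real.exp (u n - c * n)) atTop (𝓝 0) := by
  refine Real.tendsto_exp_atBot.comp (tendsto_atBot_mono' _ ?_
    (tendsto_natCast_atTop_atTop.const_mul_atTop_of_neg (neg_neg_of_pos (half_pos hc))))
  filter_upwards [hu.def (half_pos hc)] with n hn
  rw [Real.norm_natCast] at hn
  linarith [(le_abs_self (u n)).trans hn]

end Asymptotics

theorem numNonzero_isLittleO {p : ℕ → ℕ}
    (hp : (fun n => (p n : ℝ)) =o[atTop] (fun n : ℕ => (n : ℝ))) (β : (n : ℕ) → E (p n)) :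
    (fun n => (numNonzero (β n) : ℝ)) =o[atTop] (fun n : ℕ => (n : ℝ)) :=
  IsBigO.trans_isLittleO (.of_bound' (.of_forall fun n => by
    simpa only [Real.norm_natCast, Nat.cast_le] using numNonzero_le (β n))) hp

theorem tendsto_marginalPosterior_of_isLittleO_norm_score {γ k₁ k₂ : ℝ} (hγ : 0 < γ)
    (hk₁ : 0 < k₁) (hk₁' : k₁ ≤ 1) (hk : k₁ < k₂) {p : ℕ → ℕ}
    {X : (n : ℕ) → Matrix (Fin n) (Fin (p n)) ℝ} {β₀ : (n : ℕ) → E (p n)} {y : (n : ℕ) → E n}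
    {L b : ℕ → ℝ} {σ S : ℝ} (hσ : 0 < σ)
    (hp : (fun n => (p n : ℝ)) =o[atTop] (fun n : ℕ => (n : ℝ)))
    (hXl : ∀ᶠ n : ℕ in atTop, ∀ h, σ * √(n : ℝ) * ‖h‖ ≤ ‖mean (X n) h‖)
    (hXu : ∀ᶠ n : ℕ in atTop, ∀ h, ‖mean (X n) h‖ ≤ S * √(n : ℝ) * ‖h‖)
    (hτ : (fun n => ‖score (X n) (β₀ n) (y n)‖) =o[atTop] (fun n : ℕ => (n : ℝ)))
    (hL : ∀ᶠ n in atTop, 0 < L n)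
    (hLm : (fun n => L n * √(numNonzero (β₀ n) : ℝ)) =o[atTop] (fun n : ℕ => (n : ℝ)))
    (hb : b =o[atTop] (fun n : ℕ => (n : ℝ)))
    (hLb : ∀ᶠ n in atTop, ∀ j, L n * |β₀ n j| ≤ Real.exp (b n)) {ε : ℝ} (hε : 0 < ε) :
    Tendsto (fun n => marginalPosterior (X n) γ k₁ k₂ (L n) (y n) {β | ε < ‖β - β₀ n‖})
      atTop (𝓝 0) := by
  obtain ⟨A, C, hbound⟩ := exists_marginalPosterior_le hγ hk₁ hk₁' hk (S := S) hσ
  have hfar := eventually_forall_lt_mul_add_le ((hτ.const_mul_left 2).add (hLm.const_mul_left 2))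
    ((numNonzero_isLittleO hp β₀).const_mul_left 2) hε (show 0 < σ ^ 2 / 2 by positivity)
  have hexp := (tendsto_exp_sub_mul_of_isLittleO
    (((hb.norm_left.const_mul_left 2).add (hp.const_mul_left C)).add (hτ.const_mul_left γ))
    (show 0 < γ / 8 * σ ^ 2 * ε ^ 2 by positivity)).const_mul A
  rw [mul_zero] at hexp
  refine tendsto_of_tendsto_of_tendsto_of_le_of_le' tendsto_const_nhds
    (ENNReal.ofReal_zero ▸ ENNReal.tendsto_ofReal hexp) (.of_forall fun _ => zero_le) ?_
  filter_upwards [hXl, hXu, hfar, hL, hLb, hp.def one_pos, eventually_gt_atTop 0]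
    with n hXl hXu hfar hL hLb hp hn
  rw [Real.norm_natCast, Real.norm_natCast, one_mul] at hp
  refine (hbound hL (Real.sqrt_pos.2 (Nat.cast_pos.2 hn)) (by rwa [Real.sq_sqrt n.cast_nonneg])
    hXl hXu le_rfl hε.le (fun r hr => by linarith [hfar r hr]) hLb).trans_eq ?_
  rw [mul_pow, Real.sq_sqrt n.cast_nonneg, mul_assoc _ (ε ^ 2), mul_comm (ε ^ 2), Real.norm_eq_abs]

section Scale

variable {p : ℕ → ℕ} {C : ℕ → ℝ} {ρ : ℝ}

theorem pos_of_sigmaMin_pos {n p : ℕ} {X : Matrix (Fin n) (Fin p) ℝ} (h : 0 < sigmaMin X) :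
    0 < p := by
  refine Nat.pos_of_ne_zero ?_
  rintro rfl
  exact h.ne' (LinearMap.singularValues_of_finrank_le _ (by simp))

theorem eventually_scale_pos {X : (n : ℕ) → Matrix (Fin n) (Fin (p n)) ℝ} {Λ : ℝ} (hΛ : 0 < Λ)
    (hmin : (Λ : EReal) <
      liminf (fun n : ℕ => ((sigmaMin (X n) / √(n : ℝ) : ℝ) : EReal)) atTop)
    (hC : ∀ n, 0 < C n) :
    ∀ᶠ n : ℕ in atTop, 0 < C n * √(p n : ℝ) * (n : ℝ) ^ (ρ / 2) * Real.log n := by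
  filter_upwards [eventually_lt_of_lt_liminf hmin, eventually_gt_atTop 1] with n hσ hn
  have hσpos : 0 < sigmaMin (X n) :=
    pos_of_mul_pos_left (hΛ.trans (EReal.coe_lt_coe_iff.1 hσ)) (by positivity)
  have hpn : (0 : ℝ) < p n := Nat.cast_pos.2 (pos_of_sigmaMin_pos hσpos)
  have hlog : 0 < Real.log n := Real.log_pos (Nat.one_lt_cast.2 hn)
  have hCn := hC n
  positivity

theorem scale_mul_sqrt_isLittleO {m : ℕ → ℕ}
    (hm : (fun n => (m n : ℝ)) =o[atTop]
      (fun n : ℕ => (n : ℝ) ^ (1 - ρ) / ((p n : ℝ) * Real.log n ^ 2)))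
    (hC : (fun n => C n ^ 2) =o[atTop] (fun n : ℕ => (n : ℝ))) :
    (fun n : ℕ => C n * √(p n : ℝ) * (n : ℝ) ^ (ρ / 2) * Real.log n * √(m n : ℝ)) =o[atTop]
      (fun n : ℕ => (n : ℝ)) := by
  have hweight : (fun n : ℕ => (n : ℝ) ^ ρ * (p n * Real.log n ^ 2) *
      ((n : ℝ) ^ (1 - ρ) / (p n * Real.log n ^ 2))) =O[atTop] (fun n : ℕ => (n : ℝ)) := by
    refine .of_bound' ?_
    filter_upwards [eventually_gt_atTop 0] with n hn
    have hn : (0 : ℝ) < n := Nat.cast_pos.2 hn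
    rw [Real.norm_natCast, Real.norm_of_nonneg (by positivity)]
    calc (n : ℝ) ^ ρ * (p n * Real.log n ^ 2) * ((n : ℝ) ^ (1 - ρ) / (p n * Real.log n ^ 2))
        = (n : ℝ) ^ (ρ + (1 - ρ)) * (p n * Real.log n ^ 2 / (p n * Real.log n ^ 2)) := by
          rw [Real.rpow_add hn]
          ring
      _ ≤ (n : ℝ) ^ (ρ + (1 - ρ)) * 1 := by gcongr; exact div_self_le_one _
      _ = n := by rw [mul_one, add_sub_cancel, Real.rpow_one]
  refine .of_pow ?_ two_ne_zero
  refine ((hC.mul (((isBigO_refl _ _).mul_isLittleO hm).trans_isBigO hweight)).congr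
    (fun n => ?_) fun n => (sq (n : ℝ)).symm)
  rw [Pi.pow_apply]
  simp only [mul_pow, Real.sq_sqrt (Nat.cast_nonneg _), ← Real.rpow_mul_natCast n.cast_nonneg]
  norm_num
  ring

theorem scale_le_cube {n p C ρ : ℝ} (hn : 1 < n) (hpn : p ≤ n) (hC : C ^ 2 ≤ n) (hρ : ρ ≤ 1) :
    C * √p * n ^ (ρ / 2) * Real.log n ≤ n ^ 3 := by
  have hn₀ : 0 < n := one_pos.trans hn
  have hlog : 0 < Real.log n := Real.log_pos hn
  calc C * √p * n ^ (ρ / 2) * Real.log n ≤ √n * √n * n ^ (1 : ℝ) * n := by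
        gcongr
        · exact Real.le_sqrt_of_sq_le hC
        · exact hn.le
        · linarith
        · exact Real.log_le_self hn₀.le
    _ = n ^ 3 := by
        rw [Real.mul_self_sqrt hn₀.le, Real.rpow_one]
        ring

theorem exists_isLittleO_scale_mul_abs_le_exp {β : (n : ℕ) → E (p n)}
    (hp : (fun n => (p n : ℝ)) =o[atTop] (fun n : ℕ => (n : ℝ)))
    (hC : (fun n => C n ^ 2) =o[atTop] (fun n : ℕ => (n : ℝ))) (hρ : ρ ≤ 1)
    (hβ : ∃ M : ℝ, ∀ n, ∀ j, |β n j| ≤ M) :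
    ∃ b : ℕ → ℝ, b =o[atTop] (fun n : ℕ => (n : ℝ)) ∧ ∀ᶠ n : ℕ in atTop, ∀ j,
      C n * √(p n : ℝ) * (n : ℝ) ^ (ρ / 2) * Real.log n * |β n j| ≤ Real.exp (b n) := by
  obtain ⟨M, hM⟩ := hβ
  refine ⟨fun n => 4 * Real.log n,
    (Real.isLittleO_log_id_atTop.comp_tendsto tendsto_natCast_atTop_atTop).const_mul_left 4, ?_⟩
  filter_upwards [hp.def one_pos, hC.def one_pos, eventually_gt_atTop 1,
    tendsto_natCast_atTop_atTop.eventually_ge_atTop M] with n hpn hCn hn hMn j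
  rw [Real.norm_of_nonneg (by positivity), Real.norm_natCast, one_mul] at hpn hCn
  have hn₀ : (0 : ℝ) < n := Nat.cast_pos.2 (one_pos.trans hn)
  calc C n * √(p n : ℝ) * (n : ℝ) ^ (ρ / 2) * Real.log n * |β n j| ≤ (n : ℝ) ^ 3 * n := by
        gcongr
        · exact scale_le_cube (Nat.one_lt_cast.2 hn) hpn hCn hρ
        · exact (hM n j).trans hMn
    _ = Real.exp (4 * Real.log n) := by
        rw [← pow_succ, ← Real.log_rpow hn₀, Real.exp_log (by positivity)]
        norm_cast

end Scale

end BayesPenalized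

theorem theorem3_general
    {Ω : Type*} [MeasurableSpace Ω] (P : Measure Ω)
    (γ : ℝ) (hγ : 0 < γ)
    (k₁ k₂ : ℝ) (hk₁ : 0 < k₁) (hk₁' : k₁ ≤ 1) (hk : k₁ < k₂)
    (p : ℕ → ℕ)
    (X : (n : ℕ) → Matrix (Fin n) (Fin (p n)) ℝ)
    (β₀ : (n : ℕ) → BayesPenalized.E (p n))
    (L : ℕ → ℝ)
    (y : (n : ℕ) → Ω → BayesPenalized.E n)
    (hy : ∀ n, HasLaw (y n) (BayesPenalized.dataLaw (X n) γ (β₀ n)) P)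
    (hp : (fun n => (p n : ℝ)) =o[atTop] (fun n : ℕ => (n : ℝ)))
    (Λmin Λmax : ℝ) (hΛ : 0 < Λmin)
    (hmin : (Λmin : EReal) <
      liminf (fun n : ℕ => ((BayesPenalized.sigmaMin (X n) / √(n : ℝ) : ℝ) : EReal)) atTop)
    (hmax : limsup (fun n : ℕ => ((BayesPenalized.sigmaMax (X n) / √(n : ℝ) : ℝ) : EReal)) atTop
      < (Λmax : EReal))
    (hL : ∀ᶠ n in atTop, 0 < L n)
    (hLm : (fun n => L n * √(BayesPenalized.numNonzero (β₀ n) : ℝ)) =o[atTop]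
      (fun n : ℕ => (n : ℝ)))
    (hLβ : ∃ b : ℕ → ℝ, b =o[atTop] (fun n : ℕ => (n : ℝ)) ∧
      ∀ᶠ n in atTop, ∀ j, L n * |β₀ n j| ≤ Real.exp (b n)) :
    ∀ ε : ℝ, 0 < ε → ∀ᵐ ω ∂P,
      Tendsto
        (fun n : ℕ =>
          BayesPenalized.marginalPosterior (X n) γ k₁ k₂ (L n) (y n ω) {β | ε < ‖β - β₀ n‖})
        atTop (𝓝 0) := by
  obtain ⟨b, hb, hLb⟩ := hLβ
  intro ε hε
  have hlow := BayesPenalized.eventually_mul_sqrt_mul_norm_le_norm_mean hp hmin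
  have hupp := BayesPenalized.eventually_norm_mean_le_mul_sqrt_mul_norm hmax
  filter_upwards [BayesPenalized.ae_isLittleO_norm_score hγ hy hp
    (BayesPenalized.pos_of_limsup_sigmaMax_lt hmax) hupp] with ω hτ
  exact BayesPenalized.tendsto_marginalPosterior_of_isLittleO_norm_score hγ hk₁ hk₁' hk hΛ hp hlow
    hupp hτ hL hLm hb hLb hε

theorem theorem3
    {Ω : Type*} [MeasurableSpace Ω] (P : Measure Ω) [IsProbabilityMeasure P]
    (γ : ℝ) (hγ : 0 < γ)
    (k₁ k₂ : ℝ) (hk₁ : 0 < k₁) (hk₁' : k₁ ≤ 1) (hk₂ : 2 ≤ k₂)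
    (ρ : ℝ) (hρ : ρ ∈ Set.Ioo (0 : ℝ) 1)
    (p : ℕ → ℕ)
    (X : (n : ℕ) → Matrix (Fin n) (Fin (p n)) ℝ)
    (β₀ : (n : ℕ) → BayesPenalized.E (p n))
    (C : ℕ → ℝ)
    (y : (n : ℕ) → Ω → BayesPenalized.E n)
    (hy : ∀ n, HasLaw (y n) (BayesPenalized.dataLaw (X n) γ (β₀ n)) P)
    (hp : (fun n => (p n : ℝ)) =o[atTop] (fun n : ℕ => (n : ℝ)))
    (Λmin Λmax : ℝ) (hΛ : 0 < Λmin)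
    (hmin : (Λmin : EReal) <
      liminf (fun n : ℕ => ((BayesPenalized.sigmaMin (X n) / √(n : ℝ) : ℝ) : EReal)) atTop)
    (hmax : limsup (fun n : ℕ => ((BayesPenalized.sigmaMax (X n) / √(n : ℝ) : ℝ) : EReal)) atTop
      < (Λmax : EReal))
    (hβ : ∃ M : ℝ, ∀ n, ∀ j, |β₀ n j| ≤ M)
    (hm : (fun n => (BayesPenalized.numNonzero (β₀ n) : ℝ)) =o[atTop]
      (fun n : ℕ => (n : ℝ) ^ (1 - ρ) / ((p n : ℝ) * Real.log n ^ 2)))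
    (hC : ∀ n, 0 < C n)
    (hC' : (fun n => C n ^ 2) =o[atTop] (fun n : ℕ => (n : ℝ))) :
    ∀ ε : ℝ, 0 < ε → ∀ᵐ ω ∂P,
      Tendsto
        (fun n : ℕ =>
          BayesPenalized.marginalPosterior (X n) γ k₁ k₂
            (C n * √(p n : ℝ) * (n : ℝ) ^ (ρ / 2) * Real.log n) (y n ω)
            {β | ε < ‖β - β₀ n‖})
        atTop (𝓝 0) :=
  theorem3_general P γ hγ k₁ k₂ hk₁ hk₁' (by linarith) p X β₀ _ y hy hp Λmin Λmax hΛ hmin hmax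
    (BayesPenalized.eventually_scale_pos hΛ hmin hC)
    (BayesPenalized.scale_mul_sqrt_isLittleO hm hC')
    (BayesPenalized.exists_isLittleO_scale_mul_abs_le_exp hp hC' hρ.2.le hβ)
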